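/- Let $p\colon E\to B$ be a smooth real vector bundle of rank $n\ge 1$ over a non-empty compact $C^\infty$ manifold $B$ without boundary. Let $f\colon E\to\mathbb R$ be a $C^\infty$ function that is $2$-homogeneous, i.e. $f(tv)=t^2f(v)$ for all $t\ge 0$, $v\in E$, and definite, i.e. $f(v)>0$ for every $v$ outside the zero section. Put $T=f^{-1}([0,1])$, a compact manifold with boundary $\partial T=f^{-1}(1)$, and let $\mathcal F=\{f^{-1}(t)\mid t\in[0,1]\}$ be the partition of $T$ into level sets (leaves). All groups of $C^\infty$ diffeomorphisms carry the strong $C^\infty$ Whitney topology, and subgroups and products carry the induced topologies. Let - $\mathcal D_{fol}(T)$ be the group of diffeomorphisms of $T$ that map every leaf onto a leaf, $\mathcal D_{lp}(T)$ the group of those that map every leaf onto itself, and $\mathcal D_{fol}(T,\partial T)$, $\mathcal D_{lp}(T,\partial T)$ their subgroups of diffeomorphisms fixed pointwise on $\partial T$; - $\mathcal S(f)=\{h\in \mathrm{Diff}(T)\mid f\circ h^{-1}=f\}$ and $\mathcal S_{LR}(f)=\{(\varphi,h)\in\mathrm{Diff}([0,1])\times\mathrm{Diff}(T)\mid \varphi\circ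 f=f\circ h\}$ be the right and the left-right stabilizers of $f\colon T\to[0,1]$, and $\iota\colon\mathcal S(f)\to\mathcal S_{LR}(f)$, $\iota(h)=(\mathrm{id},h)$; - $\mathrm{Diff}^+([0,1])$ be the group of orientation preserving diffeomorphisms of $[0,1]$. Then $\mathcal S(f)=\mathcal D_{lp}(T)$, and the following holds. (1) For all $(\varphi,h)\in\mathcal S_{LR}(f)$ one has $\varphi\in\mathrm{Diff}^+([0,1])$ and $h\in\mathcal D_{fol}(T)$, so the projections $\mathrm{pr}_A(\varphi,h)=\varphi$ and $\mathrm{pr}_M(\varphi,h)=h$ are continuous homomorphisms $\mathrm{pr}_A\colon\mathcal S_{LR}(f)\to\mathrm{Diff}^+([0,1])$ and $\mathrm{pr}_M\colon\mathcal S_{LR}(f)\to\mathcal D_{fol}(T)$. There are continuous homomorphisms $\sigma\colon\mathcal D_{fol}(T)\to\mathrm{Diff}^+([0,1])$ with $\sigma(h)\circ f=f\circ h$, and $\theta\colon\mathrm{Diff}^+([0,1])\to\mathcal D_{fol}(T)$ given by $\theta(\varphi)(v)=\sqrt{\varphi(f(v))/f(v)}\;v$ for $f(v)\ne0$ and $\theta(\varphi)(v)=v$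 for $f(v)=0$, whose image lies in $\mathcal D_{fol}(T,\partial T)$. Put $\widehat\theta(\varphi)=(\varphi,\theta(\varphi))$ and $\widehat\sigma(h)=(\sigma(h),h)$. Both rows $$1\to\mathcal S(f)\xrightarrow{\ \iota\ }\mathcal S_{LR}(f)\xrightarrow{\mathrm{pr}_A}\mathrm{Diff}^+([0,1])\to1,\qquad 1\to\mathcal D_{lp}(T)\hookrightarrow\mathcal D_{fol}(T)\xrightarrow{\ \sigma\ }\mathrm{Diff}^+([0,1])\to1$$ are short exact sequences of continuous homomorphisms, in which the first map is a topological embedding, and they are split by the continuous sections $\widehat\theta\colon\mathrm{Diff}^+([0,1])\to\mathcal S_{LR}(f)$ and $\theta$ respectively. The map $\mathrm{pr}_M$ is an isomorphism and homeomorphism with inverse $\widehat\sigma$, and together with the identities of $\mathcal S(f)=\mathcal D_{lp}(T)$ and of $\mathrm{Diff}^+([0,1])$ it is an isomorphism from the first split sequence onto the second: $\mathrm{pr}_M\circ\iota$ is the inclusion, $\sigma\circ\mathrm{pr}_M=\mathrm{pr}_A$, and $\mathrm{pr}_M\circ\widehat\theta=\theta$. (2) The pair $(\mathcal D_{lp}(T),\mathcal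 D_{lp}(T,\partial T))$ is a strong deformation retract of the pair $(\mathcal D_{fol}(T),\mathcal D_{fol}(T,\partial T))$: there is a homotopy of $\mathcal D_{fol}(T)$ that starts at the identity, fixes $\mathcal D_{lp}(T)$ pointwise at all times, keeps $\mathcal D_{fol}(T,\partial T)$ invariant at all times, and ends in a map that sends $\mathcal D_{fol}(T)$ into $\mathcal D_{lp}(T)$ and $\mathcal D_{fol}(T,\partial T)$ into $\mathcal D_{lp}(T,\partial T)$. -/

import Mathlib

open scoped Manifold ContDiff Topology
open Set Bundle

noncomputable section

/-! ### Smooth diffeomorphisms of a subset of a manifold, with the strong Whitney topology -/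

section Diffeo

open scoped Classical in
/-- The map `M → M` that agrees with `g` on `S` and is the identity off `S`. Only its values on
`S` matter below, since it is only ever differentiated within `S`. -/
def extendById {M : Type*} (S : Set M) : Equiv.Perm S →* Equiv.Perm M :=
  Equiv.Perm.ofSubtype

theorem extendById_apply {M : Type*} {S : Set M} (g : Equiv.Perm S) (x : S) :
    extendById S g (x : M) = (g x : M) := by
  classical
  unfold extendById
  convert Equiv.Perm.ofSubtype_apply_coe g x

variable {V : Type*} [NormedAddCommGroup V] [NormedSpace ℝ V]
  {H : Type*} [TopologicalSpace H] (I : ModelWithCorners ℝ V H)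
  {M : Type*} [TopologicalSpace M] [ChartedSpace H M] (S : Set M)

/-- The bijections `g : S → S` such that `g` and `g⁻¹` are of class `C^∞` on `S`. For a
full-dimensional submanifold with boundary `S` of `M` (a regular sublevel set) these are the
`C^∞` diffeomorphisms of the manifold with boundary `S`. -/
def diffeoSubgroup : Subgroup (Equiv.Perm S) where
  carrier := {g | ContMDiffOn I I ∞ (extendById S g) S ∧ ContMDiffOn I I ∞ (extendById S g⁻¹) S}
  one_mem' := by
    simp only [mem_ofPred_eq, inv_one, map_one]
    exact ⟨contMDiffOn_id, contMDiffOn_id⟩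
  mul_mem' := by
    rintro g h ⟨hg, hg'⟩ ⟨hh, hh'⟩
    have key : ∀ a : Equiv.Perm S, MapsTo (extendById S a) S S := by
      intro a x hx
      rw [show x = ((⟨x, hx⟩ : S) : M) from rfl, extendById_apply]
      exact (a ⟨x, hx⟩).2
    simp only [mem_ofPred_eq, mul_inv_rev, map_mul, Equiv.Perm.coe_mul]
    exact ⟨hg.comp hh (key h), hh'.comp hg' (key g⁻¹)⟩
  inv_mem' := by
    rintro g ⟨hg, hg'⟩
    exact ⟨hg', by rwa [inv_inv]⟩

/-- The group `Diff(S)`. -/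
def Diffeos : Type _ := diffeoSubgroup I S

instance : Group (Diffeos I S) := inferInstanceAs (Group (diffeoSubgroup I S))

variable {I S}

/-- The underlying bijection of `S`. -/
def Diffeos.toPerm : Diffeos I S →* Equiv.Perm S := (diffeoSubgroup I S).subtype

instance : CoeFun (Diffeos I S) (fun _ => S → S) := ⟨fun g => g.toPerm⟩

theorem Diffeos.ext {g h : Diffeos I S} (H : ∀ x, g x = h x) : g = h :=
  Subtype.ext (Equiv.ext H)

@[simp] theorem Diffeos.one_apply (x : S) : (1 : Diffeos I S) x = x := rfl

@[simp] theorem Diffeos.mul_apply (g h : Diffeos I S) (x : S) : (g * h) x = g (h x) := rfl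

@[simp] theorem Diffeos.inv_apply_self (g : Diffeos I S) (x : S) : g⁻¹ (g x) = x :=
  Equiv.symm_apply_apply (Diffeos.toPerm g) x

@[simp] theorem Diffeos.apply_inv_self (g : Diffeos I S) (x : S) : g (g⁻¹ x) = x :=
  Equiv.apply_symm_apply (Diffeos.toPerm g) x

/-- The local representation `ψ ∘ g ∘ φ⁻¹` of `g` in charts `φ`, `ψ` of `M`. -/
def Diffeos.localRep (g : Diffeos I S) (φ ψ : OpenPartialHomeomorph M H) : V → V :=
  ψ.extend I ∘ extendById S g.toPerm ∘ (φ.extend I).symm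

variable (I S) in
/-- The part of `S` seen in the chart `φ`, a subset of the model vector space. -/
def chartDomain (φ : OpenPartialHomeomorph M H) : Set V :=
  φ.extend I '' (φ.source ∩ S)

/-- The set `N^r(g; Φ, Ψ, K, ε)` of all `h` such that, for each index `i`, `h` maps `K i` into the
domain of the chart `ψ i`, and on `K i` all derivatives of order at most `r` of the local
representations of `h` and `g` in the charts `φ i`, `ψ i` differ by less than `ε i`. -/
def whitneyNhd (r : ℕ) {ι : Type} (φ ψ : ι → OpenPartialHomeomorph M H) (K : ι → Set S)
    (ε : ι → ℝ) (g : Diffeos I S) : Set (Diffeos I S) :=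
  {h | ∀ i, ∀ x ∈ K i, (h x : M) ∈ (ψ i).source ∧ ∀ k ≤ r,
    ‖iteratedFDerivWithin ℝ k (h.localRep (φ i) (ψ i)) (chartDomain I S (φ i))
        ((φ i).extend I x) -
      iteratedFDerivWithin ℝ k (g.localRep (φ i) (ψ i)) (chartDomain I S (φ i))
        ((φ i).extend I x)‖ < ε i}

/-- The strong `C^∞` Whitney topology on `Diff(S)`: it is generated by the sets
`N^r(g; Φ, Ψ, K, ε)`, where `r` is finite, `Φ` is a family of smooth charts that is locally finite
on `S`, `Ψ` is a family of smooth charts, `K i` is a compact subset of `S` in the domain of `φ i`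
that `g` maps into the domain of `ψ i`, and `ε i > 0`. -/
instance : TopologicalSpace (Diffeos I S) :=
  TopologicalSpace.generateFrom
    {N | ∃ (r : ℕ) (ι : Type) (φ ψ : ι → OpenPartialHomeomorph M H) (K : ι → Set S)
        (ε : ι → ℝ) (g : Diffeos I S),
      (∀ i, φ i ∈ IsManifold.maximalAtlas I ∞ M) ∧ (∀ i, ψ i ∈ IsManifold.maximalAtlas I ∞ M) ∧
      LocallyFinite (fun i => ((↑) : S → M) ⁻¹' (φ i).source) ∧
      (∀ i, IsCompact (K i)) ∧ (∀ i, ∀ x ∈ K i, (x : M) ∈ (φ i).source) ∧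
      (∀ i, ∀ x ∈ K i, (g x : M) ∈ (ψ i).source) ∧ (∀ i, 0 < ε i) ∧
      N = whitneyNhd r φ ψ K ε g}

end Diffeo

/-! ### Diffeomorphisms of the unit interval -/

/-- `Diff([0,1])`. -/
abbrev DiffInterval : Type := Diffeos 𝓘(ℝ) unitInterval

/-- `Diff⁺([0,1])`: the orientation preserving diffeomorphisms of `[0,1]`. -/
def diffPlus : Subgroup DiffInterval where
  carrier := {φ | StrictMono φ}
  one_mem' := strictMono_id
  mul_mem' := fun ha hb => ha.comp hb
  inv_mem' := by
    intro φ hφ x y hxy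
    have hφ' : StrictMono φ := hφ
    rw [← hφ'.lt_iff_lt]
    simpa using hxy

/-! ### Level sets, foliated and leaf preserving diffeomorphisms, stabilizers -/

section Foliation

variable {V : Type*} [NormedAddCommGroup V] [NormedSpace ℝ V]
  {H : Type*} [TopologicalSpace H] (I : ModelWithCorners ℝ V H)
  {M : Type*} [TopologicalSpace M] [ChartedSpace H M] (f : M → ℝ)

/-- `T = f⁻¹([0,1])`. -/
def tube {M : Type*} (f : M → ℝ) : Set M := f ⁻¹' unitInterval

/-- `f` as a map `T → [0,1]`. -/
def tubeMap {M : Type*} (f : M → ℝ) (x : tube f) : unitInterval := ⟨f x, x.2⟩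

/-- The leaf `f⁻¹(t) ⊆ T`. -/
def leaf {M : Type*} (f : M → ℝ) (t : unitInterval) : Set (tube f) := {x | tubeMap f x = t}

/-- The partition `𝓕 = {f⁻¹(t) | t ∈ [0,1]}` of `T`. -/
def leaves {M : Type*} (f : M → ℝ) : Set (Set (tube f)) := range (leaf f)

/-- The group `Diff(T)`. -/
abbrev DiffTube : Type _ := Diffeos I (tube f)

/-- `D_fol(T)`: the diffeomorphisms of `T` that map every leaf onto a leaf. -/
def foliatedDiffeos : Subgroup (DiffTube I f) where
  carrier := {h | ∀ l ∈ leaves f, h '' l ∈ leaves f}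
  one_mem' := by
    intro l hl
    have : (1 : DiffTube I f) '' l = l := by
      ext x
      simp
    rwa [this]
  mul_mem' := by
    intro a b ha hb l hl
    have : (a * b : DiffTube I f) '' l = a '' (b '' l) := image_comp a b l
    rw [this]
    exact ha _ (hb _ hl)
  inv_mem' := by
    rintro h hh l ⟨t, rfl⟩
    rcases (leaf f t).eq_empty_or_nonempty with he | ⟨x, hx⟩
    · exact ⟨t, by rw [he, image_empty]⟩
    · obtain ⟨s, hs⟩ := hh _ ⟨tubeMap f (h⁻¹ x), rfl⟩
      have hxs : x ∈ leaf f s := by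
        rw [hs]
        exact ⟨h⁻¹ x, rfl, h.apply_inv_self x⟩
      have hst : s = t := by
        have h1 : tubeMap f x = s := hxs
        have h2 : tubeMap f x = t := hx
        exact h1.symm.trans h2
      subst hst
      refine ⟨tubeMap f (h⁻¹ x), ?_⟩
      rw [hs, image_image]
      simp

/-- `D_lp(T)`: the diffeomorphisms of `T` that map every leaf onto itself. -/
def leafPreservingDiffeos : Subgroup (DiffTube I f) where
  carrier := {h | ∀ l ∈ leaves f, h '' l = l}
  one_mem' := by
    intro l _
    ext x
    simp
  mul_mem' := by
    intro a b ha hb l hl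
    have : (a * b : DiffTube I f) '' l = a '' (b '' l) := image_comp a b l
    rw [this, hb _ hl, ha _ hl]
  inv_mem' := by
    intro h hh l hl
    conv_lhs => rw [← hh l hl]
    rw [image_image]
    simp

/-- The diffeomorphisms of `T` that are fixed on `X ⊆ T`. -/
def fixingDiffeos (X : Set (tube f)) : Subgroup (DiffTube I f) where
  carrier := {h | ∀ x ∈ X, h x = x}
  one_mem' := fun _ _ => rfl
  mul_mem' := by
    intro a b ha hb x hx
    rw [Diffeos.mul_apply, hb x hx, ha x hx]
  inv_mem' := by
    intro h hh x hx
    conv_lhs => rw [← hh x hx]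
    simp

/-- `∂T = f⁻¹(1)`. -/
def tubeBoundary {M : Type*} (f : M → ℝ) : Set (tube f) := leaf f 1

theorem leafPreserving_le_foliated : leafPreservingDiffeos I f ≤ foliatedDiffeos I f := by
  intro h hh l hl
  rw [hh l hl]
  exact hl

/-- The stabilizer of `f` under the right action: the `h ∈ Diff(T)` with `f ∘ h⁻¹ = f`. -/
def stabR : Subgroup (DiffTube I f) where
  carrier := {h | tubeMap f ∘ (h⁻¹ : DiffTube I f) = tubeMap f}
  one_mem' := by
    simp only [mem_ofPred_eq, inv_one]
    rfl
  mul_mem' := by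
    intro a b ha hb
    funext x
    rw [mul_inv_rev]
    exact (congrFun hb (a⁻¹ x)).trans (congrFun ha x)
  inv_mem' := by
    intro h hh
    funext x
    have := congrFun hh (h x)
    simp only [Function.comp_apply, Diffeos.inv_apply_self] at this
    simpa using this.symm

/-- The stabilizer of `f : T → [0,1]` under the left-right action: the pairs
`(φ, h) ∈ Diff([0,1]) × Diff(T)` with `φ ∘ f = f ∘ h`. -/
def stabLR : Subgroup (DiffInterval × DiffTube I f) where
  carrier := {p | p.1 ∘ tubeMap f = tubeMap f ∘ p.2}
  one_mem' := rfl
  mul_mem' := by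
    intro a b ha hb
    funext x
    exact (congrArg a.1 (congrFun hb x)).trans (congrFun ha (b.2 x))
  inv_mem' := by
    intro a ha
    funext x
    have h1 := congrFun ha (a.2⁻¹ x)
    simp only [Function.comp_apply, Diffeos.apply_inv_self] at h1
    simp only [Function.comp_apply, Prod.fst_inv, Prod.snd_inv, ← h1, Diffeos.inv_apply_self]

/-- The inclusion `h ↦ (id, h)` of the right stabilizer into the left-right stabilizer. -/
def stabIncl : stabR I f →ₜ* stabLR I f where
  toFun h := ⟨(1, h), by
    funext x
    have := congrFun h.2 ((h : DiffTube I f) x)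
    simp only [Function.comp_apply, Diffeos.inv_apply_self] at this
    simpa using this⟩
  map_one' := rfl
  map_mul' a b := by
    apply Subtype.ext
    apply Prod.ext
    · exact (one_mul (1 : DiffInterval)).symm
    · rfl
  continuous_toFun := by
    refine Continuous.subtype_mk ?_ _
    exact continuous_const.prodMk continuous_subtype_val

/-- The inclusion of the leaf preserving into the foliated diffeomorphisms. -/
def lpIncl : leafPreservingDiffeos I f →ₜ* foliatedDiffeos I f where
  toMonoidHom := Subgroup.inclusion (leafPreserving_le_foliated I f)
  continuous_toFun := Continuous.subtype_mk continuous_subtype_val _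

end Foliation

/-! ### Split short exact sequences and strong deformation retracts -/

/-- `1 → A → B → C → 1` is a short exact sequence of continuous homomorphisms in which `i` is a
topological embedding, and `s` is a continuous homomorphism that is a section of `p`. -/
structure IsSplitShortExact {A B C : Type*} [Group A] [Group B] [Group C]
    [TopologicalSpace A] [TopologicalSpace B] [TopologicalSpace C]
    (i : A →ₜ* B) (p : B →ₜ* C) (s : C →ₜ* B) : Prop where
  isEmbedding : Topology.IsEmbedding i
  exact_mid : ∀ b, p b = 1 ↔ b ∈ range i
  surjective : Function.Surjective p
  section_eq : ∀ c, p (s c) = c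

/-- The pair `(A, A')` of subspaces of `Y` is a strong deformation retract of the pair
`(X, X')` of subspaces of `Y`. -/
def IsStrongDeformationRetractPair {Y : Type*} [TopologicalSpace Y] (A A' X X' : Set Y) : Prop :=
  A' ⊆ A ∧ X' ⊆ X ∧ A ⊆ X ∧ A' ⊆ X' ∧
  ∃ G : C(X × unitInterval, X),
    (∀ x : X, G (x, 0) = x) ∧
    (∀ (x : X) t, (x : Y) ∈ A → G (x, t) = x) ∧
    (∀ x : X, (G (x, 1) : Y) ∈ A) ∧
    (∀ (x : X) t, (x : Y) ∈ X' → (G (x, t) : Y) ∈ X') ∧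
    (∀ x : X, (x : Y) ∈ X' → (G (x, 1) : Y) ∈ A')

/-! ### Homogeneous functions on vector bundles -/

/-- The model of the total space of a vector bundle with fiber `F` over a manifold modelled on the
vector space `VB`. -/
abbrev bundleModel (VB F : Type*) [NormedAddCommGroup VB] [NormedSpace ℝ VB]
    [NormedAddCommGroup F] [NormedSpace ℝ F] :
    ModelWithCorners ℝ (VB × F) (ModelProd VB F) :=
  𝓘(ℝ, VB).prod 𝓘(ℝ, F)

/-- `f(t v) = t^k f(v)` for all `t ≥ 0` and all vectors `v` of the bundle. -/
def IsFiberwiseHomogeneous {B F : Type*} {E : B → Type*} [∀ b, AddCommGroup (E b)]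
    [∀ b, Module ℝ (E b)] (k : ℕ) (f : TotalSpace F E → ℝ) : Prop :=
  ∀ (b : B) (v : E b) (t : ℝ), 0 ≤ t → f ⟨b, t • v⟩ = t ^ k * f ⟨b, v⟩

/-- `f` is positive off the zero section. -/
def IsFiberwiseDefinite {B F : Type*} {E : B → Type*} [∀ b, AddCommGroup (E b)]
    (f : TotalSpace F E → ℝ) : Prop :=
  ∀ (b : B) (v : E b), v ≠ 0 → 0 < f ⟨b, v⟩

end

noncomputable section

/-! ### Jointly smooth families of maps between normed spaces -/

section SmoothFamily

open Filter

/-! Smoothness together with definiteness makes `f` a rigid radial coordinate. On every line of a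
fibre it equals `t ^ 2` times a constant (`IsFiberwiseHomogeneous.apply_fiberSMul`), on every closed
half-line it determines the point (`fiberSMul_eq_of_apply_eq`), and its sublevel set `T` is compact
(`isCompact_tube`).

Levels: if `f v = 1`, a foliated `h` induces the level map `s ↦ f (h (√s v))`. The function `t ↦ f
(h (t v))` is smooth and even, because `t v` and `-t v` lie on one leaf, so Whitney's theorem on
even functions (`IsDerivFamily.exists_comp_sqrt`) makes the level map smooth up to `s = 0`. It
cannot exchange 0 and 1, since the zero section consists of critical points of `f` and the boundary
of regular ones (`levelDiffeo_apply_zero_ne_one`); hence it increases. This gives `σ`.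

Section: for an increasing `φ` the quotient `q(t) = φ(t) / t` extends to a smooth positive function
on `[0, 1]` by Hadamard's lemma, so multiplication of `v` by the square root of `q (f v)` is smooth,
and it acts on levels by `φ`. This gives `θ`; identities between radial maps need to be checked on
levels only.

Retraction: convex combinations of `σ(h)` with the identity stay in `diffPlus`, and `h` is deformed
by radial maps so that its level map runs along that segment (`exists_levelHomotopy`).

Continuity: all constructions are read as families of maps whose derivatives of every order are
jointly continuous in parameter and point (`SmoothFamilyAt`). Continuity for the Whitney topology
yields such families in charts (`ContinuousAt.smoothInChartsAt`), and on a compact domain the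
converse holds (`Diffeos.continuous_of_smoothInChartsAt`). Whitney's and Hadamard's theorems are
therefore proved with parameters. -/

/-- Derivatives of `F ξ` within `S` at `x` depend on the germ in `x` with `ξ` frozen. This turns a
property of nearby pairs into a property of such germs. -/
theorem Filter.Eventually.prod_nhdsWithin_slice {X V : Type*} [TopologicalSpace X]
    [TopologicalSpace V] {S : Set V} {ξ₀ : X} {x₀ : V} {Q : X → V → Prop}
    (h : ∀ᶠ p : X × V in 𝓝 ξ₀ ×ˢ 𝓝[S] x₀, Q p.1 p.2) :
    ∀ᶠ p : X × V in 𝓝 ξ₀ ×ˢ 𝓝[S] x₀, ∀ᶠ y in 𝓝[S] p.2, Q p.1 y := by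
  obtain ⟨pa, ha, pb, hb, H⟩ := eventually_prod_iff.1 h
  refine eventually_prod_iff.2 ⟨pa, ha, _, eventually_eventually_nhdsWithin.2 hb, ?_⟩
  intro ξ hξ x hx
  exact hx.mono fun y hy => H hξ hy

theorem Filter.Eventually.prod_nhdsWithin_self {X V : Type*} [TopologicalSpace X]
    [TopologicalSpace V] {S : Set V} {ξ₀ : X} {x₀ : V} {Q : X × V → Prop}
    (h : ∀ᶠ p : X × V in 𝓝 ξ₀ ×ˢ 𝓝[S] x₀, Q p) (hx : x₀ ∈ S) : Q (ξ₀, x₀) := by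
  obtain ⟨pa, ha, pb, hb, H⟩ := eventually_prod_iff.1 h
  exact H ha.self_of_nhds (hb.self_of_nhdsWithin hx)

variable {X : Type*} [TopologicalSpace X]
  {V : Type*} [NormedAddCommGroup V] [NormedSpace ℝ V]
  {W : Type*} [NormedAddCommGroup W] [NormedSpace ℝ W]
  {Z : Type*} [NormedAddCommGroup Z] [NormedSpace ℝ Z]

/-- The maps `F ξ` are smooth within `S` near `x₀` for `ξ` near `ξ₀`, and their derivatives of
every order depend continuously on `(ξ, x)` at `(ξ₀, x₀)`. -/
def SmoothFamilyAt (F : X → V → W) (S : Set V) (ξ₀ : X) (x₀ : V) : Prop :=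
  ∀ k : ℕ, (∀ᶠ p : X × V in 𝓝 ξ₀ ×ˢ 𝓝[S] x₀, ContDiffWithinAt ℝ k (F p.1) S p.2) ∧
    Tendsto (fun p : X × V => iteratedFDerivWithin ℝ k (F p.1) S p.2) (𝓝 ξ₀ ×ˢ 𝓝[S] x₀)
      (𝓝 (iteratedFDerivWithin ℝ k (F ξ₀) S x₀))

namespace SmoothFamilyAt

variable {F F' : X → V → W} {S : Set V} {ξ₀ : X} {x₀ : V}

theorem tendsto (h : SmoothFamilyAt F S ξ₀ x₀) :
    Tendsto (fun p : X × V => F p.1 p.2) (𝓝 ξ₀ ×ˢ 𝓝[S] x₀) (𝓝 (F ξ₀ x₀)) := by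
  have h0 := (h 0).2
  simp only [iteratedFDerivWithin_zero_eq_comp, Function.comp_def] at h0
  have := ((continuousMultilinearCurryFin0 ℝ V W).continuous.tendsto _).comp h0
  simpa [Function.comp_def] using this

theorem contDiffWithinAt (h : SmoothFamilyAt F S ξ₀ x₀) (hx : x₀ ∈ S) :
    ContDiffWithinAt ℝ ∞ (F ξ₀) S x₀ :=
  contDiffWithinAt_infty.2 fun k => (h k).1.prod_nhdsWithin_self hx

theorem congr (h : SmoothFamilyAt F S ξ₀ x₀) (hx : x₀ ∈ S)
    (hF : ∀ᶠ p : X × V in 𝓝 ξ₀ ×ˢ 𝓝[S] x₀, F' p.1 p.2 = F p.1 p.2) :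
    SmoothFamilyAt F' S ξ₀ x₀ := by
  intro k
  have hs := Filter.Eventually.prod_nhdsWithin_slice (Q := fun ξ x => F' ξ x = F ξ x) hF
  refine ⟨?_, ?_⟩
  · filter_upwards [(h k).1, hs, hF] with p hp hq hpq
    exact hp.congr_of_eventuallyEq hq hpq
  · have e : ∀ᶠ p : X × V in 𝓝 ξ₀ ×ˢ 𝓝[S] x₀, iteratedFDerivWithin ℝ k (F p.1) S p.2 =
        iteratedFDerivWithin ℝ k (F' p.1) S p.2 := by
      filter_upwards [hs, hF] with p hq hpq
      exact (Filter.EventuallyEq.iteratedFDerivWithin_eq (𝕜 := ℝ) hq hpq k).symm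
    have e0 := e.prod_nhdsWithin_self hx
    simp only at e0
    rw [← e0]
    exact (h k).2.congr' e

theorem const {G : V → W} (hS : UniqueDiffOn ℝ S) (hx : x₀ ∈ S)
    (hG : ContDiffWithinAt ℝ ∞ G S x₀) : SmoothFamilyAt (fun _ : X => G) S ξ₀ x₀ := by
  intro k
  refine ⟨?_, ?_⟩
  · have := (hG.of_le (m := k) (by exact_mod_cast le_top)).eventually (by simp)
    rw [insert_eq_of_mem hx] at this
    exact this.prod_inr _
  · have := hG.continuousWithinAt_iteratedFDerivWithin (k := k) hS (by exact_mod_cast le_top) hx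
    exact Tendsto.comp this tendsto_snd

theorem param {c : X → W} (hc : ContinuousAt c ξ₀) :
    SmoothFamilyAt (fun ξ (_ : V) => c ξ) S ξ₀ x₀ := by
  intro k
  refine ⟨Eventually.of_forall fun p => contDiffWithinAt_const, ?_⟩
  rcases k with _ | k
  · simp only [iteratedFDerivWithin_zero_eq_comp, Function.comp_def]
    exact ((continuousMultilinearCurryFin0 ℝ V W).symm.continuous.tendsto _).comp
      (hc.tendsto.comp tendsto_fst)
  · simp only [iteratedFDerivWithin_succ_const]
    exact tendsto_const_nhds

/-- By Faà di Bruno's formula the `k`-th derivative of the composite is a finite sum, over ordered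
partitions, of continuous expressions in the derivatives of `G ξ` and `F ξ`, so the limit can be
taken term by term. -/
theorem comp {G : X → W → Z} {S' : Set W} (hG : SmoothFamilyAt G S' ξ₀ (F ξ₀ x₀))
    (hF : SmoothFamilyAt F S ξ₀ x₀) (hS : UniqueDiffOn ℝ S) (hS' : UniqueDiffOn ℝ S')
    (hx : x₀ ∈ S) (hm : ∀ᶠ p : X × V in 𝓝 ξ₀ ×ˢ 𝓝[S] x₀, F p.1 p.2 ∈ S') :
    SmoothFamilyAt (fun ξ => G ξ ∘ F ξ) S ξ₀ x₀ := by
  have ht : Tendsto (fun p : X × V => (p.1, F p.1 p.2)) (𝓝 ξ₀ ×ˢ 𝓝[S] x₀)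
      (𝓝 ξ₀ ×ˢ 𝓝[S'] (F ξ₀ x₀)) :=
    tendsto_fst.prodMk (tendsto_nhdsWithin_iff.2 ⟨hF.tendsto, hm⟩)
  have hms := Filter.Eventually.prod_nhdsWithin_slice (Q := fun ξ x => F ξ x ∈ S') hm
  have hmem : ∀ᶠ p : X × V in 𝓝 ξ₀ ×ˢ 𝓝[S] x₀, p.2 ∈ S :=
    (eventually_mem_nhdsWithin (a := x₀) (s := S)).prod_inr _
  intro k
  refine ⟨?_, ?_⟩
  · filter_upwards [(hF k).1, ht.eventually (hG k).1, hms] with p h1 h2 h3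
    exact h2.comp_of_preimage_mem_nhdsWithin _ h1 h3
  · have e : ∀ᶠ p : X × V in 𝓝 ξ₀ ×ˢ 𝓝[S] x₀,
        (ftaylorSeriesWithin ℝ (G p.1) S' (F p.1 p.2)).taylorComp
          (ftaylorSeriesWithin ℝ (F p.1) S p.2) k =
        iteratedFDerivWithin ℝ k (G p.1 ∘ F p.1) S p.2 := by
      filter_upwards [(hF k).1, ht.eventually (hG k).1, hms, hmem] with p h1 h2 h3 h4
      exact (iteratedFDerivWithin_comp_of_eventually_mem h2 h1 hS' hS h4 h3 le_rfl).symm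
    have e0 := e.prod_nhdsWithin_self hx
    simp only at e0
    rw [← e0]
    refine Tendsto.congr' e ?_
    simp only [FormalMultilinearSeries.taylorComp]
    refine tendsto_finsetSum _ fun c _ => ?_
    have h1 : Tendsto (fun p : X × V => (ftaylorSeriesWithin ℝ (G p.1) S' (F p.1 p.2)) c.length)
        (𝓝 ξ₀ ×ˢ 𝓝[S] x₀) (𝓝 ((ftaylorSeriesWithin ℝ (G ξ₀) S' (F ξ₀ x₀)) c.length)) :=
      (hG c.length).2.comp ht
    have h2 : Tendsto (fun (p : X × V) (i : Fin c.length) =>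
        (ftaylorSeriesWithin ℝ (F p.1) S p.2) (c.partSize i)) (𝓝 ξ₀ ×ˢ 𝓝[S] x₀)
        (𝓝 fun i => (ftaylorSeriesWithin ℝ (F ξ₀) S x₀) (c.partSize i)) :=
      tendsto_pi_nhds.2 fun i => (hF (c.partSize i)).2
    have hc : Continuous fun q : (W [×c.length]→L[ℝ] Z) ×
        (∀ i : Fin c.length, V [×c.partSize i]→L[ℝ] W) =>
        c.compAlongOrderedFinpartitionL ℝ V W Z q.1 q.2 := by
      fun_prop
    exact (hc.tendsto _).comp (h1.prodMk_nhds h2)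

theorem prodMk {G : X → V → Z} (hF : SmoothFamilyAt F S ξ₀ x₀) (hG : SmoothFamilyAt G S ξ₀ x₀)
    (hS : UniqueDiffOn ℝ S) (hx : x₀ ∈ S) :
    SmoothFamilyAt (fun ξ x => (F ξ x, G ξ x)) S ξ₀ x₀ := by
  have hmem : ∀ᶠ p : X × V in 𝓝 ξ₀ ×ˢ 𝓝[S] x₀, p.2 ∈ S :=
    (eventually_mem_nhdsWithin (a := x₀) (s := S)).prod_inr _
  intro k
  refine ⟨?_, ?_⟩
  · filter_upwards [(hF k).1, (hG k).1] with p h1 h2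
    exact h1.prodMk h2
  · have e : ∀ᶠ p : X × V in 𝓝 ξ₀ ×ˢ 𝓝[S] x₀,
        (iteratedFDerivWithin ℝ k (F p.1) S p.2).prod (iteratedFDerivWithin ℝ k (G p.1) S p.2) =
        iteratedFDerivWithin ℝ k (fun x => (F p.1 x, G p.1 x)) S p.2 := by
      filter_upwards [(hF k).1, (hG k).1, hmem] with p h1 h2 h3
      exact (iteratedFDerivWithin_prodMk h1 h2 hS h3 le_rfl).symm
    have e0 := e.prod_nhdsWithin_self hx
    simp only at e0
    rw [← e0]
    refine Tendsto.congr' e ?_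
    exact ((ContinuousMultilinearMap.prodL ℝ (fun _ : Fin k => V) W Z).continuous.tendsto _).comp
      ((hF k).2.prodMk_nhds (hG k).2)

/-- Composition with a fixed map that is smooth near the relevant value. -/
theorem comp_left {G : W → Z} (hF : SmoothFamilyAt F S ξ₀ x₀) (hS : UniqueDiffOn ℝ S)
    (hx : x₀ ∈ S) (hG : ContDiffAt ℝ ∞ G (F ξ₀ x₀)) :
    SmoothFamilyAt (fun ξ x => G (F ξ x)) S ξ₀ x₀ :=
  (SmoothFamilyAt.const uniqueDiffOn_univ (mem_univ _) hG.contDiffWithinAt).comp hF hS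
    uniqueDiffOn_univ hx (Eventually.of_forall fun _ => mem_univ _)

end SmoothFamilyAt

end SmoothFamily

/-! ### Families of smooth functions on a compact interval -/

section IntervalFamily

open Filter

variable {X : Type*} [TopologicalSpace X] {a b : ℝ}

/-- `d k ξ` is the `k`-th derivative of `d 0 ξ` on `[a, b]`, and it is continuous in both
variables. -/
structure IsDerivFamily (a b : ℝ) (d : ℕ → X → ℝ → ℝ) : Prop where
  hasDerivWithinAt : ∀ k ξ, ∀ t ∈ Icc a b,
    HasDerivWithinAt (d k ξ) (d (k + 1) ξ t) (Icc a b) t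
  continuousOn : ∀ k, ContinuousOn (fun p : X × ℝ => d k p.1 p.2) (univ ×ˢ Icc a b)

namespace IsDerivFamily

variable {d : ℕ → X → ℝ → ℝ}

theorem iteratedDerivWithin_eq (h : IsDerivFamily a b d) (hab : a < b) (k : ℕ) (ξ : X) :
    EqOn (iteratedDerivWithin k (d 0 ξ) (Icc a b)) (d k ξ) (Icc a b) := by
  induction k with
  | zero => intro t _; simp
  | succ k ih =>
    intro t ht
    rw [iteratedDerivWithin_succ, derivWithin_congr ih (ih ht)]
    exact (h.hasDerivWithinAt k ξ t ht).derivWithin (uniqueDiffOn_Icc hab t ht)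

theorem contDiffOn (h : IsDerivFamily a b d) (hab : a < b) (ξ : X) :
    ContDiffOn ℝ ∞ (d 0 ξ) (Icc a b) := by
  refine contDiffOn_of_differentiableOn_deriv fun m _ t ht => ?_
  exact ((h.hasDerivWithinAt m ξ t ht).differentiableWithinAt).congr
    (fun s hs => h.iteratedDerivWithin_eq hab m ξ hs) (h.iteratedDerivWithin_eq hab m ξ ht)

theorem continuousOn_slice (h : IsDerivFamily a b d) (k : ℕ) (ξ : X) :
    ContinuousOn (d k ξ) (Icc a b) := fun t ht => (h.hasDerivWithinAt k ξ t ht).continuousWithinAt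

theorem smoothFamilyAt (h : IsDerivFamily a b d) (hab : a < b) (ξ : X) {t : ℝ}
    (ht : t ∈ Icc a b) : SmoothFamilyAt (d 0) (Icc a b) ξ t := by
  have hmem : ∀ᶠ p : X × ℝ in 𝓝 ξ ×ˢ 𝓝[Icc a b] t, p.2 ∈ Icc a b :=
    (eventually_mem_nhdsWithin (a := t) (s := Icc a b)).prod_inr _
  intro k
  refine ⟨?_, ?_⟩
  · filter_upwards [hmem] with p hp
    exact ((h.contDiffOn hab p.1) p.2 hp).of_le (by exact_mod_cast le_top)
  · simp only [iteratedFDerivWithin_eq_equiv_comp, Function.comp_def]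
    refine ((ContinuousMultilinearMap.piFieldEquiv ℝ (Fin k) ℝ).continuous.tendsto _).comp ?_
    rw [h.iteratedDerivWithin_eq hab k ξ ht]
    have hc := h.continuousOn k (ξ, t) ⟨mem_univ _, ht⟩
    rw [ContinuousWithinAt, nhdsWithin_prod_eq, nhdsWithin_univ] at hc
    refine hc.congr' ?_
    filter_upwards [hmem] with p hp
    exact (h.iteratedDerivWithin_eq hab k p.1 hp).symm

theorem of_smoothFamilyAt {F : X → ℝ → ℝ} (hab : a < b)
    (hF : ∀ ξ, ∀ t ∈ Icc a b, SmoothFamilyAt F (Icc a b) ξ t) :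
    IsDerivFamily a b (fun k ξ => iteratedDerivWithin k (F ξ) (Icc a b)) := by
  have hu := uniqueDiffOn_Icc hab
  refine ⟨fun k ξ t ht => ?_, fun k p hp => ?_⟩
  · rw [iteratedDerivWithin_succ]
    have hc : ContDiffOn ℝ ∞ (F ξ) (Icc a b) := fun s hs => (hF ξ s hs).contDiffWithinAt hs
    exact (hc.differentiableOn_iteratedDerivWithin (m := k)
      (by exact_mod_cast WithTop.coe_lt_top k) hu t ht).hasDerivWithinAt
  · have := ((hF p.1 p.2 hp.2) k).2
    rw [ContinuousWithinAt, nhdsWithin_prod_eq, nhdsWithin_univ]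
    simp only [iteratedDerivWithin_eq_equiv_comp, Function.comp_def]
    exact ((ContinuousMultilinearMap.piFieldEquiv ℝ (Fin k) ℝ).symm.continuous.tendsto _).comp this

/-- The average of the derivatives along segments from `0`: this is the sequence of derivatives of
`(d 0 t - d 0 0) / t`. -/
def average (d : ℕ → X → ℝ → ℝ) (k : ℕ) (ξ : X) (t : ℝ) : ℝ :=
  ∫ s in (0 : ℝ)..1, s ^ k * d (k + 1) ξ (s * t)

theorem mul_mem_Icc {s t : ℝ} (h0 : (0 : ℝ) ∈ Icc a b) (hs : s ∈ Icc (0 : ℝ) 1)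
    (ht : t ∈ Icc a b) : s * t ∈ Icc a b := by
  have := (convex_Icc a b).smul_mem_of_zero_mem h0 ht hs
  simpa using this

/-- The fundamental theorem of calculus for `u ↦ d k ξ (s * u)`. The case `s = 1` is Hadamard's
lemma; general `s` is needed to differentiate `average`. -/
theorem segment_integral (h : IsDerivFamily a b d) (h0 : (0 : ℝ) ∈ Icc a b) (k : ℕ) (ξ : X)
    {s t : ℝ} (hs : s ∈ Icc (0 : ℝ) 1) (ht : t ∈ Icc a b) :
    ∫ u in (0 : ℝ)..t, s * d (k + 1) ξ (s * u) = d k ξ (s * t) - d k ξ 0 := by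
  have hsub : uIcc 0 t ⊆ Icc a b := uIcc_subset_Icc h0 ht
  have hmap : MapsTo (fun u => s * u) (uIcc 0 t) (Icc a b) :=
    fun u hu => mul_mem_Icc h0 hs (hsub hu)
  have hder : ∀ u ∈ uIcc 0 t, HasDerivWithinAt (fun u => d k ξ (s * u))
      (s * d (k + 1) ξ (s * u)) (uIcc 0 t) u := by
    intro u hu
    have h1 := (h.hasDerivWithinAt k ξ (s * u) (hmap hu)).comp u
      (((hasDerivAt_id u).const_mul s).hasDerivWithinAt (s := uIcc 0 t)) hmap
    simpa [Function.comp_def, mul_comm] using h1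
  have hc : ContinuousOn (fun u => s * d (k + 1) ξ (s * u)) (uIcc 0 t) :=
    continuousOn_const.mul ((h.continuousOn_slice (k + 1) ξ).comp
      (by fun_prop) hmap)
  have := intervalIntegral.integral_eq_sub_of_hasDeriv_right
    (f := fun u => d k ξ (s * u)) (f' := fun u => s * d (k + 1) ξ (s * u)) (a := 0) (b := t)
    (fun u hu => (hder u hu).continuousWithinAt) ?_ hc.intervalIntegrable
  · simpa using this
  · intro u hu
    have hu' : u ∈ uIcc 0 t := Ioo_subset_Icc_self hu
    refine ((hder u hu').hasDerivAt ?_).hasDerivWithinAt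
    exact Icc_mem_nhds hu.1 hu.2

theorem mul_average (h : IsDerivFamily a b d) (h0 : (0 : ℝ) ∈ Icc a b) (ξ : X) {t : ℝ}
    (ht : t ∈ Icc a b) : t * average d 0 ξ t = d 0 ξ t - d 0 ξ 0 := by
  have h1 := h.segment_integral h0 0 ξ (s := 1) (by simp) ht
  simp only [one_mul, zero_add] at h1
  rw [← h1, average]
  simp

/-- Differentiation under the integral sign by way of Fubini: the `k`-th average is its value at 0
plus the integral of the `(k + 1)`-st, which is continuous. -/
theorem isDerivFamily_average (h : IsDerivFamily a b d) (h0 : (0 : ℝ) ∈ Icc a b) :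
    IsDerivFamily a b (average d) := by
  have hab : a ≤ b := h0.1.trans h0.2
  -- Extending by the end values makes all integrands continuous on the whole of `X × ℝ`, so that
  -- parametric integrals and Fubini apply without one-sided statements.
  let e : ℕ → X → ℝ → ℝ := fun k ξ t => d k ξ (projIcc a b hab t)
  have he : ∀ k, Continuous fun p : X × ℝ => e k p.1 p.2 := fun k =>
    (h.continuousOn k).comp_continuous (f := fun p : X × ℝ => (p.1, (projIcc a b hab p.2 : ℝ)))
      (continuous_fst.prodMk (continuous_subtype_val.comp (continuous_projIcc.comp continuous_snd)))
      fun p => ⟨mem_univ _, (projIcc a b hab p.2).2⟩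
  have hed : ∀ k ξ, ∀ t ∈ Icc a b, e k ξ t = d k ξ t := fun k ξ t ht => by
    simp only [e, projIcc_of_mem hab ht]
  let D : ℕ → X × ℝ → ℝ := fun k p => ∫ s in (0 : ℝ)..1, s ^ k * e (k + 1) p.1 (s * p.2)
  have hint : ∀ k, Continuous fun q : (X × ℝ) × ℝ => q.2 ^ k * e (k + 1) q.1.1 (q.2 * q.1.2) :=
    fun k => (continuous_snd.pow k).mul ((he (k + 1)).comp
      (f := fun q : (X × ℝ) × ℝ => (q.1.1, q.2 * q.1.2)) (by fun_prop))
  have hD : ∀ k, Continuous (D k) := fun k =>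
    intervalIntegral.continuous_parametric_intervalIntegral_of_continuous' (hint k) 0 1
  have hDd : ∀ k ξ, ∀ t ∈ Icc a b, average d k ξ t = D k (ξ, t) := by
    intro k ξ t ht
    refine intervalIntegral.integral_congr fun s hs => ?_
    rw [uIcc_of_le zero_le_one] at hs
    simp only [hed _ _ _ (mul_mem_Icc h0 hs ht)]
  have key : ∀ k ξ, ∀ t ∈ Icc a b, D k (ξ, t) = D k (ξ, 0) + ∫ u in (0 : ℝ)..t, D (k + 1) (ξ, u) := by
    intro k ξ t ht
    have hsw : ∫ u in (0 : ℝ)..t, D (k + 1) (ξ, u) =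
        ∫ s in (0 : ℝ)..1, ∫ u in (0 : ℝ)..t, s ^ (k + 1) * e (k + 2) ξ (s * u) := by
      refine MeasureTheory.intervalIntegral_intervalIntegral_swap ?_
      have hc : Continuous (Function.uncurry fun u s : ℝ => s ^ (k + 1) * e (k + 2) ξ (s * u)) :=
        (hint (k + 1)).comp (f := fun q : ℝ × ℝ => ((ξ, q.1), q.2)) (by fun_prop)
      exact (hc.continuousOn.integrableOn_compact (isCompact_uIcc.prod isCompact_uIcc)).mono_set
        (prod_mono uIoc_subset_uIcc uIoc_subset_uIcc)
    have hcs : ∀ t, Continuous fun s : ℝ => s ^ k * e (k + 1) ξ (s * t) := fun t =>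
      (hint k).comp (f := fun s : ℝ => ((ξ, t), s)) (by fun_prop)
    rw [hsw, ← sub_eq_iff_eq_add', ← intervalIntegral.integral_sub
      ((hcs t).intervalIntegrable _ _) ((hcs 0).intervalIntegrable _ _)]
    refine intervalIntegral.integral_congr fun s hs => ?_
    rw [uIcc_of_le zero_le_one] at hs
    have h1 := h.segment_integral h0 (k + 1) ξ hs ht
    have h2 : ∫ u in (0 : ℝ)..t, s ^ (k + 1) * e (k + 2) ξ (s * u) =
        s ^ k * ∫ u in (0 : ℝ)..t, s * d (k + 1 + 1) ξ (s * u) := by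
      rw [← intervalIntegral.integral_const_mul]
      refine intervalIntegral.integral_congr fun u hu => ?_
      have hu' := mul_mem_Icc h0 hs (uIcc_subset_Icc h0 ht hu)
      simp only [hed _ _ _ hu']
      ring
    simp only [h2, h1, hed _ _ _ (mul_mem_Icc h0 hs ht), mul_zero, hed _ _ _ h0]
    ring
  refine ⟨fun k ξ t ht => ?_, fun k => ?_⟩
  · have hc : Continuous fun u => D (k + 1) (ξ, u) := (hD (k + 1)).comp (by fun_prop)
    have h1 : HasDerivAt (fun t => D k (ξ, 0) + ∫ u in (0 : ℝ)..t, D (k + 1) (ξ, u))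
        (D (k + 1) (ξ, t)) t :=
      (intervalIntegral.integral_hasDerivAt_right (hc.intervalIntegrable _ _)
        (hc.stronglyMeasurableAtFilter _ _) hc.continuousAt).const_add _
    rw [hDd _ _ _ ht]
    exact h1.hasDerivWithinAt.congr (fun s hs => (hDd _ _ _ hs).trans (key _ _ _ hs))
      ((hDd _ _ _ ht).trans (key _ _ _ ht))
  · exact (hD k).continuousOn.congr fun p hp => hDd k p.1 p.2 hp.2

theorem shift (h : IsDerivFamily a b d) : IsDerivFamily a b (fun k => d (k + 1)) :=
  ⟨fun k => h.hasDerivWithinAt (k + 1), fun k => h.continuousOn (k + 1)⟩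

theorem const_mul (h : IsDerivFamily a b d) (c : ℝ) :
    IsDerivFamily a b (fun k ξ t => c * d k ξ t) :=
  ⟨fun k ξ t ht => (h.hasDerivWithinAt k ξ t ht).const_mul c,
    fun k => continuousOn_const.mul (h.continuousOn k)⟩

theorem deriv_odd_of_even (h : IsDerivFamily (-1) 1 d)
    (he : ∀ ξ, ∀ t ∈ Icc (-1 : ℝ) 1, d 0 ξ (-t) = d 0 ξ t) (ξ : X) {t : ℝ}
    (ht : t ∈ Icc (-1 : ℝ) 1) : d 1 ξ (-t) = -d 1 ξ t := by
  have hneg : MapsTo (fun u : ℝ => -u) (Icc (-1) 1) (Icc (-1) 1) := fun u hu =>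
    ⟨neg_le_neg hu.2, by simpa using neg_le_neg hu.1⟩
  have h1 := (h.hasDerivWithinAt 0 ξ (-t) (hneg ht)).comp t
    ((hasDerivAt_neg t).hasDerivWithinAt (s := Icc (-1 : ℝ) 1)) hneg
  have h2 : HasDerivWithinAt (d 0 ξ) (d 1 ξ (-t) * -1) (Icc (-1) 1) t :=
    h1.congr (fun u hu => (he ξ u hu).symm) (he ξ t ht).symm
  have h3 := (uniqueDiffOn_Icc (by norm_num : (-1 : ℝ) < 1) t ht).eq_deriv _ h2
    (h.hasDerivWithinAt 0 ξ t ht)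
  simp only [zero_add] at h3
  linarith

/-- The derivative of `s ↦ g (√s)` for an even smooth `g` has again the form `s ↦ g' (√s)` with an
even smooth `g'`. -/
theorem exists_deriv_comp_sqrt (h : IsDerivFamily (-1) 1 d)
    (he : ∀ ξ, ∀ t ∈ Icc (-1 : ℝ) 1, d 0 ξ (-t) = d 0 ξ t) :
    ∃ d' : ℕ → X → ℝ → ℝ, IsDerivFamily (-1) 1 d' ∧
      (∀ ξ, ∀ t ∈ Icc (-1 : ℝ) 1, d' 0 ξ (-t) = d' 0 ξ t) ∧
      ∀ ξ, ∀ s ∈ Icc (0 : ℝ) 1,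
        HasDerivWithinAt (fun s => d 0 ξ √s) (d' 0 ξ √s) (Icc 0 1) s := by
  have h0 : (0 : ℝ) ∈ Icc (-1 : ℝ) 1 := by norm_num
  have hfam := (h.shift.isDerivFamily_average h0)
  have hodd := fun ξ t => h.deriv_odd_of_even he ξ (t := t)
  have hd0 : ∀ ξ, d 1 ξ 0 = 0 := fun ξ => by
    have := hodd ξ 0 h0
    rw [neg_zero] at this
    linarith
  have hmul : ∀ ξ, ∀ t ∈ Icc (-1 : ℝ) 1, t * average (fun k => d (k + 1)) 0 ξ t = d 1 ξ t := by
    intro ξ t ht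
    have := h.shift.mul_average h0 ξ ht
    simpa [hd0] using this
  -- The chain rule gives `g'(√s) / (2 √s)`. Since `g'` is odd, `g'(t) / t` is the smooth even
  -- function `average`; the factor 2 accounts for the `1 / 2`.
  refine ⟨_, hfam.const_mul (1 / 2), ?_, ?_⟩
  · intro ξ t ht
    rcases eq_or_ne t 0 with rfl | hne
    · rw [neg_zero]
    · have ht' : -t ∈ Icc (-1 : ℝ) 1 := ⟨neg_le_neg ht.2, by linarith [ht.1]⟩
      have h1 := hmul ξ t ht
      have h2 := hmul ξ (-t) ht'
      rw [hodd ξ t ht, ← h1] at h2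
      have h3 : t * (average (fun k => d (k + 1)) 0 ξ (-t)) =
          t * average (fun k => d (k + 1)) 0 ξ t := by linarith
      rw [mul_left_cancel₀ hne h3]
  · intro ξ
    set A := average (fun k => d (k + 1)) 0 ξ with hA
    have hsq : ∀ s ∈ Icc (0 : ℝ) 1, √s ∈ Icc (-1 : ℝ) 1 := fun s hs =>
      ⟨by linarith [Real.sqrt_nonneg s], Real.sqrt_le_one.2 hs.2⟩
    have hcA : ContinuousOn (fun s => 1 / 2 * A √s) (Icc 0 1) :=
      continuousOn_const.mul ((hfam.continuousOn_slice 0 ξ).comp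
        Real.continuous_sqrt.continuousOn hsq)
    have hcd : ContinuousOn (fun s => d 0 ξ √s) (Icc 0 1) :=
      (h.continuousOn_slice 0 ξ).comp Real.continuous_sqrt.continuousOn hsq
    -- The square root is not differentiable at 0, so the chain rule is used for `0 < u < 1` only.
    -- The integral identity needs just continuity at the end points, and its integrand is
    -- continuous at 0, which yields the derivative there as well.
    have hint : ∀ s ∈ Icc (0 : ℝ) 1, d 0 ξ √s = d 0 ξ √0 + ∫ u in (0 : ℝ)..s, 1 / 2 * A √u := by
      intro s hs
      have hsub : Icc 0 s ⊆ Icc (0 : ℝ) 1 := Icc_subset_Icc_right hs.2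
      rw [intervalIntegral.integral_eq_sub_of_hasDerivAt_of_le hs.1 (hcd.mono hsub)]
      · simp
      · intro u hu
        have hu1 : u < 1 := hu.2.trans_le hs.2
        have hpos : 0 < √u := Real.sqrt_pos.2 hu.1
        have hlt : √u < 1 := by rw [Real.sqrt_lt' one_pos]; simpa using hu1
        have hg : HasDerivAt (d 0 ξ) (d 1 ξ √u) √u :=
          (h.hasDerivWithinAt 0 ξ _ (hsq u ⟨hu.1.le, hu1.le⟩)).hasDerivAt
            (Icc_mem_nhds (by linarith) hlt)
        have := hg.comp u (Real.hasDerivAt_sqrt hu.1.ne')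
        refine this.congr_deriv ?_
        rw [← hmul ξ √u (hsq u ⟨hu.1.le, hu1.le⟩), ← hA]
        field_simp
      · refine ContinuousOn.intervalIntegrable ?_
        rw [uIcc_of_le hs.1]
        exact hcA.mono hsub
    intro s hs
    let c : ℝ → ℝ := fun u => 1 / 2 * A √(projIcc (0 : ℝ) 1 zero_le_one u : ℝ)
    have hc : Continuous c := hcA.comp_continuous
      (continuous_subtype_val.comp continuous_projIcc) fun u => (projIcc _ _ _ u).2
    have hcs : ∀ u ∈ Icc (0 : ℝ) 1, c u = 1 / 2 * A √u := fun u hu => by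
      simp only [c, projIcc_of_mem zero_le_one hu]
    have h1 : HasDerivAt (fun s => d 0 ξ √0 + ∫ u in (0 : ℝ)..s, c u) (c s) s :=
      (intervalIntegral.integral_hasDerivAt_right (hc.intervalIntegrable _ _)
        (hc.stronglyMeasurableAtFilter _ _) hc.continuousAt).const_add _
    rw [← hcs s hs]
    have heq : ∀ s ∈ Icc (0 : ℝ) 1, d 0 ξ √s = d 0 ξ √0 + ∫ u in (0 : ℝ)..s, c u := by
      intro s hs
      rw [hint s hs]
      congr 1
      refine intervalIntegral.integral_congr fun u hu => (hcs u ?_).symm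
      rw [uIcc_of_le hs.1] at hu
      exact ⟨hu.1, hu.2.trans hs.2⟩
    exact h1.hasDerivWithinAt.congr heq (heq s hs)

/-- **Whitney's theorem on even functions**, with parameters: an even smooth function on `[-1, 1]`
is a smooth function of the square of the variable. -/
theorem exists_comp_sqrt (h : IsDerivFamily (-1) 1 d)
    (he : ∀ ξ, ∀ t ∈ Icc (-1 : ℝ) 1, d 0 ξ (-t) = d 0 ξ t) :
    ∃ d' : ℕ → X → ℝ → ℝ, IsDerivFamily 0 1 d' ∧ d' 0 = fun ξ s => d 0 ξ √s := by
  let P : (ℕ → X → ℝ → ℝ) → Prop := fun d => IsDerivFamily (-1) 1 d ∧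
    ∀ ξ, ∀ t ∈ Icc (-1 : ℝ) 1, d 0 ξ (-t) = d 0 ξ t
  have hstep : ∀ d : {d // P d}, ∃ d' : {d // P d}, ∀ ξ, ∀ s ∈ Icc (0 : ℝ) 1,
      HasDerivWithinAt (fun s => d.1 0 ξ √s) (d'.1 0 ξ √s) (Icc 0 1) s := by
    rintro ⟨d, hd, hde⟩
    obtain ⟨d', h1, h2, h3⟩ := hd.exists_deriv_comp_sqrt hde
    exact ⟨⟨d', h1, h2⟩, h3⟩
  choose next hnext using hstep
  -- Evenness and smoothness survive each differentiation in `s`, so the step iterates: the `k`-th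
  -- derivative is the `k`-th even function evaluated at `√s`.
  let g : ℕ → {d // P d} := fun k => next^[k] ⟨d, h, he⟩
  have hg : ∀ k, g (k + 1) = next (g k) := fun k => Function.iterate_succ_apply' _ _ _
  refine ⟨fun k ξ s => (g k).1 0 ξ √s, ⟨fun k ξ s hs => ?_, fun k => ?_⟩, rfl⟩
  · rw [hg]
    exact hnext (g k) ξ s hs
  · refine ((g k).2.1.continuousOn 0).comp (f := fun p : X × ℝ => (p.1, √p.2))
      (by fun_prop) fun p hp => ⟨mem_univ _, ?_, ?_⟩
    · linarith [Real.sqrt_nonneg p.2]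
    · exact Real.sqrt_le_one.2 hp.2.2

end IsDerivFamily

end IntervalFamily

/-! ### Continuity for the Whitney topology in terms of smooth families -/

section Whitney

open Filter

variable {V : Type*} [NormedAddCommGroup V] [NormedSpace ℝ V]
  {H : Type*} [TopologicalSpace H] {I : ModelWithCorners ℝ V H}
  {M : Type*} [TopologicalSpace M] {S : Set M}
  {X : Type*} [TopologicalSpace X]

theorem mem_chartDomain {φ : OpenPartialHomeomorph M H} (x : S) (hx : (x : M) ∈ φ.source) :
    φ.extend I x ∈ chartDomain I S φ := mem_image_of_mem _ ⟨hx, x.2⟩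

theorem map_extend_nhds_subtype (φ : OpenPartialHomeomorph M H) {x : S} (hx : (x : M) ∈ φ.source) :
    map (fun y : S => φ.extend I y) (𝓝 x) = 𝓝[chartDomain I S φ] (φ.extend I x) := by
  have h := φ.map_extend_nhdsWithin_eq_image (I := I) (s := S) hx
  rw [φ.extend_source] at h
  rw [chartDomain, ← h, ← map_nhds_subtype_val, map_map]
  rfl

/-- The dictionary between limits over points of `S` and limits over their coordinates, with the
parameter carried along. -/
theorem prod_nhdsWithin_chartDomain (φ : OpenPartialHomeomorph M H) (ξ : X) {x : S}
    (hx : (x : M) ∈ φ.source) :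
    𝓝 ξ ×ˢ 𝓝[chartDomain I S φ] (φ.extend I x) =
      map (fun p : X × S => (p.1, φ.extend I p.2)) (𝓝 (ξ, x)) := by
  rw [← map_extend_nhds_subtype φ hx, nhds_prod_eq]
  exact (Filter.prod_map_right _ _ _)

variable [ChartedSpace H M]
  {W : Type*} [NormedAddCommGroup W] [NormedSpace ℝ W]

theorem OpenPartialHomeomorph.contMDiffAt_extend_symm [I.Boundaryless]
    {φ : OpenPartialHomeomorph M H}
    (hφ : φ ∈ IsManifold.maximalAtlas I ∞ M) {x : M} (hx : x ∈ φ.source) :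
    ContMDiffAt 𝓘(ℝ, V) I ∞ (φ.extend I).symm (φ.extend I x) := by
  refine (contMDiffOn_extend_symm hφ).contMDiffAt ?_
  rw [← φ.extend_target']
  have := φ.extend_target_mem_nhdsWithin (I := I) hx
  rwa [I.range_eq_univ, nhdsWithin_univ] at this

theorem ContMDiffAt.contDiffAt_comp_extend_symm [I.Boundaryless] {u : M → W} {x : M}
    (hu : ContMDiffAt I 𝓘(ℝ, W) ∞ u x) {φ : OpenPartialHomeomorph M H}
    (hφ : φ ∈ IsManifold.maximalAtlas I ∞ M) (hx : x ∈ φ.source) :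
    ContDiffAt ℝ ∞ (u ∘ (φ.extend I).symm) (φ.extend I x) := by
  rw [← contMDiffAt_iff_contDiffAt]
  refine ContMDiffAt.comp (I' := I) _ ?_ (φ.contMDiffAt_extend_symm hφ hx)
  rwa [φ.extend_left_inv hx]

namespace Diffeos

theorem contMDiffOn_extendById (g : Diffeos I S) : ContMDiffOn I I ∞ (extendById S g.toPerm) S :=
  g.2.1

theorem continuous_apply (g : Diffeos I S) : Continuous fun x : S => (g x : M) := by
  have := continuousOn_iff_continuous_domRestrict.1 g.contMDiffOn_extendById.continuousOn
  convert! this using 2 with x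
  exact (extendById_apply g.toPerm x).symm

theorem localRep_apply (g : Diffeos I S) {φ : OpenPartialHomeomorph M H}
    (ψ : OpenPartialHomeomorph M H) {x : S} (hx : (x : M) ∈ φ.source) :
    g.localRep φ ψ (φ.extend I x) = ψ.extend I (g x) := by
  simp only [localRep, Function.comp_apply, φ.extend_left_inv hx, extendById_apply]

theorem contDiffWithinAt_localRep (g : Diffeos I S) {φ ψ : OpenPartialHomeomorph M H}
    (hφ : φ ∈ IsManifold.maximalAtlas I ∞ M) (hψ : ψ ∈ IsManifold.maximalAtlas I ∞ M)
    {x : S} (hx : (x : M) ∈ φ.source) (hgx : (g x : M) ∈ ψ.source) :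
    ContDiffWithinAt ℝ ∞ (g.localRep φ ψ) (chartDomain I S φ) (φ.extend I x) := by
  have h1 : ContMDiffWithinAt I I ∞ (extendById S g.toPerm) (φ.source ∩ S) x :=
    (g.contMDiffOn_extendById x x.2).mono inter_subset_right
  refine ((contMDiffWithinAt_iff_image hφ hψ inter_subset_left hx ?_).1 h1).2
  rwa [extendById_apply]

end Diffeos

/-- In the charts `φ` and `ψ`, the diffeomorphisms `h ξ` form a smooth family near
`(ξ₀, x₀)`. -/
structure SmoothInChartsAt (h : X → Diffeos I S) (φ ψ : OpenPartialHomeomorph M H)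
    (ξ₀ : X) (x₀ : S) : Prop where
  mem_source : (x₀ : M) ∈ φ.source
  apply_mem_source : (h ξ₀ x₀ : M) ∈ ψ.source
  eventually_mem : ∀ᶠ p : X × S in 𝓝 (ξ₀, x₀), (h p.1 p.2 : M) ∈ ψ.source
  smoothFamilyAt : SmoothFamilyAt (fun ξ => (h ξ).localRep φ ψ) (chartDomain I S φ) ξ₀
    (φ.extend I x₀)

theorem isOpen_whitneyNhd_single {φ ψ : OpenPartialHomeomorph M H}
    (hφ : φ ∈ IsManifold.maximalAtlas I ∞ M) (hψ : ψ ∈ IsManifold.maximalAtlas I ∞ M)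
    (r : ℕ) {K : Set S} (hK : IsCompact K) {ε : ℝ} (hε : 0 < ε) (g : Diffeos I S)
    (hKφ : ∀ x ∈ K, (x : M) ∈ φ.source) (hKψ : ∀ x ∈ K, (g x : M) ∈ ψ.source) :
    IsOpen (whitneyNhd r (fun _ : Unit => φ) (fun _ => ψ) (fun _ => K) (fun _ => ε) g) :=
  TopologicalSpace.isOpen_generateFrom_of_mem ⟨r, Unit, _, _, _, _, g, fun _ => hφ, fun _ => hψ,
    locallyFinite_of_finite _, fun _ => hK, fun _ => hKφ, fun _ => hKψ, fun _ => hε, rfl⟩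

theorem mem_whitneyNhd_self {ι : Type} (r : ℕ) (φ ψ : ι → OpenPartialHomeomorph M H)
    (K : ι → Set S) (ε : ι → ℝ) (g : Diffeos I S) (hψ : ∀ i, ∀ x ∈ K i, (g x : M) ∈ (ψ i).source)
    (hε : ∀ i, 0 < ε i) : g ∈ whitneyNhd r φ ψ K ε g := by
  intro i x hx
  refine ⟨hψ i x hx, fun k _ => ?_⟩
  simpa using hε i

/-- On a compact neighbourhood of `x₀` a Whitney neighbourhood with a single chart makes the
derivatives of `h ξ` uniformly close to those of `h ξ₀`, which are continuous; an `ε / 2` argument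
combines the two into joint convergence. Each single `h ξ` is smooth by definition. -/
theorem ContinuousAt.smoothInChartsAt [LocallyCompactSpace S] {h : X → Diffeos I S} {ξ₀ : X}
    (hh : ContinuousAt h ξ₀) {x₀ : S} {φ ψ : OpenPartialHomeomorph M H}
    (hφ : φ ∈ IsManifold.maximalAtlas I ∞ M) (hψ : ψ ∈ IsManifold.maximalAtlas I ∞ M)
    (hu : UniqueDiffOn ℝ (chartDomain I S φ))
    (hx : (x₀ : M) ∈ φ.source) (hgx : (h ξ₀ x₀ : M) ∈ ψ.source) :
    SmoothInChartsAt h φ ψ ξ₀ x₀ := by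
  have hU : (((↑) : S → M) ⁻¹' φ.source) ∩ ((fun x : S => (h ξ₀ x : M)) ⁻¹' ψ.source) ∈ 𝓝 x₀ :=
    inter_mem ((φ.open_source.preimage continuous_subtype_val).mem_nhds hx)
      ((ψ.open_source.preimage (h ξ₀).continuous_apply).mem_nhds hgx)
  obtain ⟨K, hKx, hKU, hK⟩ := local_compact_nhds hU
  have hev : ∀ (r : ℕ) (ε : ℝ), 0 < ε → ∀ᶠ p : X × S in 𝓝 (ξ₀, x₀),
      h p.1 ∈ whitneyNhd r (fun _ : Unit => φ) (fun _ => ψ) (fun _ => K) (fun _ => ε) (h ξ₀) ∧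
        p.2 ∈ K := by
    intro r ε hε
    have ho := isOpen_whitneyNhd_single hφ hψ r hK hε (h ξ₀) (fun x hx => (hKU hx).1)
      (fun x hx => (hKU hx).2)
    have hm := mem_whitneyNhd_self r (fun _ : Unit => φ) (fun _ => ψ) (fun _ => K) (fun _ => ε)
      (h ξ₀) (fun _ x hx => (hKU hx).2) (fun _ => hε)
    rw [nhds_prod_eq]
    exact (hh.eventually (ho.mem_nhds hm)).prod_mk hKx
  refine ⟨hx, hgx, (hev 0 1 one_pos).mono fun p hp => (hp.1 () _ hp.2).1, fun k => ⟨?_, ?_⟩⟩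
  · rw [prod_nhdsWithin_chartDomain φ ξ₀ hx, eventually_map]
    filter_upwards [hev 0 1 one_pos] with p hp
    exact ((h p.1).contDiffWithinAt_localRep hφ hψ (hKU hp.2).1 (hp.1 () _ hp.2).1).of_le
      (by exact_mod_cast le_top)
  · have hc := ((h ξ₀).contDiffWithinAt_localRep hφ hψ hx
      hgx).continuousWithinAt_iteratedFDerivWithin (k := k) hu (by exact_mod_cast le_top)
      (mem_chartDomain x₀ hx)
    rw [ContinuousWithinAt, ← map_extend_nhds_subtype φ hx, tendsto_map'_iff] at hc
    rw [prod_nhdsWithin_chartDomain φ ξ₀ hx, tendsto_map'_iff, Metric.tendsto_nhds]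
    intro ε hε
    have h2 : ∀ᶠ p : X × S in 𝓝 (ξ₀, x₀), dist
        (iteratedFDerivWithin ℝ k ((h ξ₀).localRep φ ψ) (chartDomain I S φ) (φ.extend I p.2))
        (iteratedFDerivWithin ℝ k ((h ξ₀).localRep φ ψ) (chartDomain I S φ) (φ.extend I x₀))
          < ε / 2 := by
      rw [nhds_prod_eq]
      exact ((Metric.tendsto_nhds.1 hc) (ε / 2) (half_pos hε)).prod_inr _
    filter_upwards [hev k (ε / 2) (half_pos hε), h2] with p hp hp2
    have h3 := (hp.1 () _ hp.2).2 k le_rfl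
    rw [← dist_eq_norm] at h3
    calc _ ≤ _ := dist_triangle _
          (iteratedFDerivWithin ℝ k ((h ξ₀).localRep φ ψ) (chartDomain I S φ) (φ.extend I p.2)) _
      _ < ε / 2 + ε / 2 := add_lt_add h3 hp2
      _ = ε := add_halves ε

theorem SmoothInChartsAt.tendsto {h : X → Diffeos I S} {φ ψ : OpenPartialHomeomorph M H}
    {ξ₀ : X} {x₀ : S} (hs : SmoothInChartsAt h φ ψ ξ₀ x₀) :
    Tendsto (fun p : X × S => (h p.1 p.2 : M)) (𝓝 (ξ₀, x₀)) (𝓝 (h ξ₀ x₀ : M)) := by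
  have h1 := hs.smoothFamilyAt.tendsto
  rw [prod_nhdsWithin_chartDomain φ ξ₀ hs.mem_source, tendsto_map'_iff,
    (h ξ₀).localRep_apply ψ hs.mem_source] at h1
  have h2 := (ψ.continuousAt_extend_symm (I := I) hs.apply_mem_source).tendsto.comp h1
  rw [ψ.extend_left_inv hs.apply_mem_source] at h2
  refine h2.congr' ?_
  have h3 : ∀ᶠ p : X × S in 𝓝 (ξ₀, x₀), (p.2 : M) ∈ φ.source := by
    rw [nhds_prod_eq]
    exact Eventually.prod_inr
      ((φ.open_source.preimage continuous_subtype_val).mem_nhds hs.mem_source) _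
  filter_upwards [hs.eventually_mem, h3] with p hp hp'
  simp only [Function.comp_apply, (h p.1).localRep_apply ψ hp', ψ.extend_left_inv hp]

/-- The basic open sets of the Whitney topology use arbitrary charts, whereas a family is best
examined in one convenient pair. Coordinate changes are fixed smooth maps, so they can be composed
on both sides. -/
theorem SmoothInChartsAt.change_charts [I.Boundaryless] {h : X → Diffeos I S}
    {φ ψ φ' ψ' : OpenPartialHomeomorph M H} {ξ₀ : X} {x₀ : S}
    (hs : SmoothInChartsAt h φ ψ ξ₀ x₀)
    (hφ : φ ∈ IsManifold.maximalAtlas I ∞ M) (hψ : ψ ∈ IsManifold.maximalAtlas I ∞ M)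
    (hφ' : φ' ∈ IsManifold.maximalAtlas I ∞ M) (hψ' : ψ' ∈ IsManifold.maximalAtlas I ∞ M)
    (hu : ∀ φ ∈ IsManifold.maximalAtlas I ∞ M, UniqueDiffOn ℝ (chartDomain I S φ))
    (hx : (x₀ : M) ∈ φ'.source) (hgx : (h ξ₀ x₀ : M) ∈ ψ'.source) :
    SmoothInChartsAt h φ' ψ' ξ₀ x₀ := by
  have hev : ∀ᶠ p : X × S in 𝓝 (ξ₀, x₀), (h p.1 p.2 : M) ∈ ψ'.source :=
    hs.tendsto.eventually (ψ'.open_source.mem_nhds hgx)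
  have hsrc : ∀ χ : OpenPartialHomeomorph M H, (x₀ : M) ∈ χ.source →
      ∀ᶠ p : X × S in 𝓝 (ξ₀, x₀), (p.2 : M) ∈ χ.source := by
    intro χ hχ
    rw [nhds_prod_eq]
    exact Eventually.prod_inr
      ((χ.open_source.preimage continuous_subtype_val).mem_nhds hχ) _
  refine ⟨hx, hgx, hev, ?_⟩
  have hx' := mem_chartDomain (I := I) x₀ hx
  have h1 : ContDiffAt ℝ ∞ (φ.extend I ∘ (φ'.extend I).symm) (φ'.extend I x₀) :=
    (φ.contMDiffAt_extend hφ hs.mem_source).contDiffAt_comp_extend_symm hφ' hx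
  have h2 : ContDiffAt ℝ ∞ (ψ'.extend I ∘ (ψ.extend I).symm) (ψ.extend I (h ξ₀ x₀)) :=
    (ψ'.contMDiffAt_extend hψ' hgx).contDiffAt_comp_extend_symm hψ hs.apply_mem_source
  have e1 : (φ.extend I ∘ (φ'.extend I).symm) (φ'.extend I x₀) = φ.extend I x₀ := by
    rw [Function.comp_apply, φ'.extend_left_inv hx]
  have f1 : SmoothFamilyAt (fun _ : X => φ.extend I ∘ (φ'.extend I).symm) (chartDomain I S φ')
      ξ₀ (φ'.extend I x₀) :=
    SmoothFamilyAt.const (hu _ hφ') hx' h1.contDiffWithinAt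
  have f2 := SmoothFamilyAt.comp (G := fun ξ => (h ξ).localRep φ ψ) (S' := chartDomain I S φ)
    (by rw [e1]; exact hs.smoothFamilyAt) f1 (hu _ hφ') (hu _ hφ) hx' (by
      rw [prod_nhdsWithin_chartDomain φ' ξ₀ hx, eventually_map]
      filter_upwards [hsrc φ hs.mem_source, hsrc φ' hx] with p hp hp'
      simp only [Function.comp_apply, φ'.extend_left_inv hp']
      exact mem_chartDomain p.2 hp)
  have f3 := f2.comp_left (G := ψ'.extend I ∘ (ψ.extend I).symm) (hu _ hφ') hx' (by
    rw [Function.comp_apply, e1, (h ξ₀).localRep_apply ψ hs.mem_source]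
    exact h2)
  refine f3.congr hx' ?_
  rw [prod_nhdsWithin_chartDomain φ' ξ₀ hx, eventually_map]
  filter_upwards [hsrc φ hs.mem_source, hsrc φ' hx, hs.eventually_mem] with p hp hp' hp3
  simp only [Function.comp_apply, φ'.extend_left_inv hp', (h p.1).localRep_apply _ hp',
    (h p.1).localRep_apply _ hp, ψ.extend_left_inv hp3]

/-- A family of diffeomorphisms of a compact `S` that is smooth in suitable charts near each point
is continuous for the Whitney topology. -/
theorem Diffeos.continuous_of_smoothInChartsAt [I.Boundaryless] [CompactSpace S]
    {h : X → Diffeos I S}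
    (hu : ∀ φ ∈ IsManifold.maximalAtlas I ∞ M, UniqueDiffOn ℝ (chartDomain I S φ))
    (hs : ∀ ξ₀ x₀, ∃ φ ∈ IsManifold.maximalAtlas I ∞ M, ∃ ψ ∈ IsManifold.maximalAtlas I ∞ M,
      SmoothInChartsAt h φ ψ ξ₀ x₀) : Continuous h := by
  refine continuous_generateFrom_iff.2 ?_
  rintro _ ⟨r, ι, φ, ψ, K, ε, g, hφ, hψ, hlf, hK, hKφ, hKψ, hε, rfl⟩
  rw [isOpen_iff_mem_nhds]
  intro ξ₀ hξ₀
  -- A locally finite family of chart domains on a compact space has only finitely many nonempty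
  -- members. For every other index `K i` is empty and imposes no condition.
  have hfin := hlf.finite_nonempty_of_compact
  have key : ∀ i, ∀ᶠ ξ in 𝓝 ξ₀, ∀ x ∈ K i, (h ξ x : M) ∈ (ψ i).source ∧ ∀ k ≤ r,
      ‖iteratedFDerivWithin ℝ k ((h ξ).localRep (φ i) (ψ i)) (chartDomain I S (φ i))
          ((φ i).extend I x) -
        iteratedFDerivWithin ℝ k (g.localRep (φ i) (ψ i)) (chartDomain I S (φ i))
          ((φ i).extend I x)‖ < ε i := by
    intro i
    -- Compactness of `K i` reduces a neighbourhood of `ξ₀` that works for all of `K i` to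
    -- neighbourhoods of the single pairs `(ξ₀, x)`.
    refine (hK i).eventually_forall_of_forall_eventually fun x hx => ?_
    obtain ⟨φ', hφ', ψ', hψ', hsm⟩ := hs ξ₀ x
    have hsm' := hsm.change_charts hφ' hψ' (hφ i) (hψ i) hu (hKφ i x hx) (hξ₀ i x hx).1
    refine hsm'.eventually_mem.and ?_
    have hfinite : ∀ᶠ p : X × S in 𝓝 (ξ₀, x), ∀ k ∈ Finset.range (r + 1),
        ‖iteratedFDerivWithin ℝ k ((h p.1).localRep (φ i) (ψ i)) (chartDomain I S (φ i))
          ((φ i).extend I p.2) -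
        iteratedFDerivWithin ℝ k (g.localRep (φ i) (ψ i)) (chartDomain I S (φ i))
          ((φ i).extend I p.2)‖ < ε i := by
      rw [eventually_all_finset]
      intro k hk
      have h1 := (hsm'.smoothFamilyAt k).2
      rw [prod_nhdsWithin_chartDomain (φ i) ξ₀ (hKφ i x hx), tendsto_map'_iff] at h1
      have hc := (g.contDiffWithinAt_localRep (hφ i) (hψ i) (hKφ i x hx)
        (hKψ i x hx)).continuousWithinAt_iteratedFDerivWithin (k := k) (hu _ (hφ i))
        (by exact_mod_cast le_top) (mem_chartDomain x (hKφ i x hx))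
      rw [ContinuousWithinAt, ← map_extend_nhds_subtype (φ i) (hKφ i x hx),
        tendsto_map'_iff] at hc
      have hc' := hc.comp (tendsto_snd (f := 𝓝 ξ₀) (g := 𝓝 x))
      rw [← nhds_prod_eq] at hc'
      -- The basic set is centred at `g`, not at `h ξ₀`; the strict inequality at `(ξ₀, x)` persists
      -- nearby because both derivatives converge.
      exact (h1.sub hc').norm.eventually_lt_const
        ((hξ₀ i x hx).2 k (Nat.lt_succ_iff.1 (Finset.mem_range.1 hk)))
    filter_upwards [hfinite] with p hp k hk
    exact hp k (Finset.mem_range.2 (Nat.lt_succ_iff.2 hk))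
  filter_upwards [(eventually_all_finite hfin).2 fun i _ => key i] with ξ hξ i x hx
  exact hξ i ⟨x, hKφ i x hx⟩ x hx

end Whitney

/-! ### Change of parameter, unique differentiability in charts, construction of diffeomorphisms -/

section Reparametrization

open Filter

theorem SmoothFamilyAt.reparam {X Y V W : Type*} [TopologicalSpace X] [TopologicalSpace Y]
    [NormedAddCommGroup V] [NormedSpace ℝ V] [NormedAddCommGroup W] [NormedSpace ℝ W]
    {F : X → V → W} {S : Set V} {x₀ : V} {c : Y → X} {η₀ : Y}
    (h : SmoothFamilyAt F S (c η₀) x₀) (hc : ContinuousAt c η₀) :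
    SmoothFamilyAt (fun η => F (c η)) S η₀ x₀ := by
  have ht : Tendsto (fun p : Y × V => (c p.1, p.2)) (𝓝 η₀ ×ˢ 𝓝[S] x₀)
      (𝓝 (c η₀) ×ˢ 𝓝[S] x₀) := (hc.tendsto.comp tendsto_fst).prodMk tendsto_snd
  exact fun k => ⟨ht.eventually (h k).1, (h k).2.comp ht⟩

variable {V : Type*} [NormedAddCommGroup V] [NormedSpace ℝ V]
  {H : Type*} [TopologicalSpace H] {I : ModelWithCorners ℝ V H}
  {M : Type*} [TopologicalSpace M] [ChartedSpace H M] {S : Set M}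

/-- Unique differentiability passes to images under maps whose derivatives have dense range, and
those of a chart are surjective. It is what makes derivatives within chart domains well behaved at
boundary points of `S`. -/
theorem UniqueMDiffOn.uniqueDiffOn_chartDomain (hS : UniqueMDiffOn I S)
    {φ : OpenPartialHomeomorph M H} (hφ : φ ∈ IsManifold.maximalAtlas I ∞ M) :
    UniqueDiffOn ℝ (chartDomain I S φ) := by
  have hd : φ.MDifferentiable I I :=
    ⟨(contMDiffOn_of_mem_maximalAtlas hφ).mdifferentiableOn (by simp),
      (contMDiffOn_symm_of_mem_maximalAtlas hφ).mdifferentiableOn (by simp)⟩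
  have h1 : UniqueMDiffOn I (φ.source ∩ S) := by
    rw [inter_comm]
    exact hS.inter φ.open_source
  rw [← uniqueMDiffOn_iff_uniqueDiffOn, chartDomain]
  refine h1.image_denseRange' (f' := fun y => (mfderiv I I φ y : _)) (fun y hy => ?_) fun y hy =>
    (hd.mfderiv_surjective hy.1).denseRange
  exact (I.hasMFDerivAt.comp y (hd.mdifferentiableAt hy.1).hasMFDerivAt).hasMFDerivWithinAt

/-- A bijection of `S` that is, together with its inverse, the restriction of a smooth map. -/
def Diffeos.ofPerm (e : Equiv.Perm S)
    (h : ∃ u : M → M, ContMDiffOn I I ∞ u S ∧ ∀ x : S, (e x : M) = u x)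
    (h' : ∃ w : M → M, ContMDiffOn I I ∞ w S ∧ ∀ x : S, (e.symm x : M) = w x) : Diffeos I S :=
  ⟨e, by
    obtain ⟨u, hu, hue⟩ := h
    obtain ⟨w, hw, hwe⟩ := h'
    refine ⟨hu.congr fun x hx => ?_, hw.congr fun x hx => ?_⟩
    · exact (extendById_apply e ⟨x, hx⟩).trans (hue ⟨x, hx⟩)
    · exact (extendById_apply e⁻¹ ⟨x, hx⟩).trans (hwe ⟨x, hx⟩)⟩

end Reparametrization

/-! ### Diffeomorphisms of the unit interval as real functions -/

section Interval

open Filter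

/-- A diffeomorphism of `[0, 1]`, extended to `ℝ`. -/
def intervalFun (φ : DiffInterval) : ℝ → ℝ := extendById unitInterval φ.toPerm

theorem intervalFun_coe (φ : DiffInterval) (t : unitInterval) : intervalFun φ t = φ t :=
  extendById_apply φ.toPerm t

theorem intervalFun_of_mem (φ : DiffInterval) {t : ℝ} (ht : t ∈ Icc (0 : ℝ) 1) :
    intervalFun φ t = φ ⟨t, ht⟩ :=
  extendById_apply φ.toPerm ⟨t, ht⟩

theorem intervalFun_mem (φ : DiffInterval) {t : ℝ} (ht : t ∈ Icc (0 : ℝ) 1) :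
    intervalFun φ t ∈ Icc (0 : ℝ) 1 := by
  rw [intervalFun_of_mem φ ht]
  exact (φ ⟨t, ht⟩).2

theorem contDiffOn_intervalFun (φ : DiffInterval) : ContDiffOn ℝ ∞ (intervalFun φ) (Icc 0 1) :=
  contMDiffOn_iff_contDiffOn.1 φ.contMDiffOn_extendById

theorem intervalFun_inv_intervalFun (φ : DiffInterval) {t : ℝ} (ht : t ∈ Icc (0 : ℝ) 1) :
    intervalFun φ⁻¹ (intervalFun φ t) = t := by
  rw [intervalFun_of_mem φ ht, intervalFun_coe, Diffeos.inv_apply_self]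

theorem refl_mem_maximalAtlas :
    OpenPartialHomeomorph.refl ℝ ∈ IsManifold.maximalAtlas 𝓘(ℝ) ∞ ℝ := by
  have := IsManifold.chart_mem_maximalAtlas (I := 𝓘(ℝ)) (n := ∞) (0 : ℝ)
  rwa [chartAt_self_eq] at this

theorem chartDomain_refl :
    chartDomain 𝓘(ℝ) unitInterval (OpenPartialHomeomorph.refl ℝ) = Icc 0 1 := by
  simp [chartDomain, unitInterval]

theorem uniqueDiffOn_chartDomain_unitInterval :
    ∀ φ ∈ IsManifold.maximalAtlas 𝓘(ℝ) ∞ ℝ, UniqueDiffOn ℝ (chartDomain 𝓘(ℝ) unitInterval φ) :=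
  fun _ hφ => UniqueMDiffOn.uniqueDiffOn_chartDomain
    (uniqueMDiffOn_iff_uniqueDiffOn.2 uniqueDiffOn_Icc_zero_one) hφ

variable {X : Type*} [TopologicalSpace X]

theorem ContinuousAt.smoothFamilyAt_intervalFun {h : X → DiffInterval} {ξ₀ : X}
    (hh : ContinuousAt h ξ₀) {t : ℝ} (ht : t ∈ Icc (0 : ℝ) 1) :
    SmoothFamilyAt (fun ξ => intervalFun (h ξ)) (Icc 0 1) ξ₀ t := by
  have := (hh.smoothInChartsAt (x₀ := ⟨t, ht⟩) refl_mem_maximalAtlas refl_mem_maximalAtlas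
    (uniqueDiffOn_chartDomain_unitInterval _ refl_mem_maximalAtlas) (by simp)
    (by simp)).smoothFamilyAt
  rw [chartDomain_refl] at this
  exact this

theorem DiffInterval.continuous_of_smoothFamilyAt {h : X → DiffInterval}
    (hs : ∀ ξ, ∀ t ∈ Icc (0 : ℝ) 1, SmoothFamilyAt (fun ξ => intervalFun (h ξ)) (Icc 0 1) ξ t) :
    Continuous h := by
  refine Diffeos.continuous_of_smoothInChartsAt uniqueDiffOn_chartDomain_unitInterval
    fun ξ x => ⟨_, refl_mem_maximalAtlas, _, refl_mem_maximalAtlas, by simp, by simp,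
      Eventually.of_forall fun _ => by simp, ?_⟩
  rw [chartDomain_refl]
  exact hs ξ x x.2

/-- The chain rule for `φ⁻¹ ∘ φ = id` shows that the derivative is a factor of 1. -/
theorem derivWithin_intervalFun_ne_zero (φ : DiffInterval) {t : ℝ} (ht : t ∈ Icc (0 : ℝ) 1) :
    derivWithin (intervalFun φ) (Icc 0 1) t ≠ 0 := by
  have hd : ∀ (ψ : DiffInterval), ∀ s ∈ Icc (0 : ℝ) 1,
      HasDerivWithinAt (intervalFun ψ) (derivWithin (intervalFun ψ) (Icc 0 1) s) (Icc 0 1) s :=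
    fun ψ s hs => ((contDiffOn_intervalFun ψ).differentiableOn (by simp) s hs).hasDerivWithinAt
  have h1 := (hd φ⁻¹ _ (intervalFun_mem φ ht)).comp t (hd φ t ht)
    fun s hs => intervalFun_mem φ hs
  have h2 : HasDerivWithinAt (fun s : ℝ => s) _ (Icc 0 1) t :=
    h1.congr (fun s hs => (intervalFun_inv_intervalFun φ hs).symm)
      (intervalFun_inv_intervalFun φ ht).symm
  have h3 := (uniqueDiffOn_Icc_zero_one t ht).eq_deriv _ h2 (hasDerivWithinAt_id t _)
  intro h0
  rw [h0, mul_zero] at h3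
  exact zero_ne_one h3

theorem diffPlus_apply_zero (φ : diffPlus) : (φ : DiffInterval) 0 = 0 := by
  have hm : StrictMono (φ : DiffInterval) := φ.2
  refine le_antisymm ?_ unitInterval.nonneg'
  have := hm.monotone (unitInterval.nonneg' (t := (φ : DiffInterval)⁻¹ 0))
  rwa [Diffeos.apply_inv_self] at this

theorem diffPlus_apply_one (φ : diffPlus) : (φ : DiffInterval) 1 = 1 := by
  have hm : StrictMono (φ : DiffInterval) := φ.2
  refine le_antisymm unitInterval.le_one' ?_
  have := hm.monotone (unitInterval.le_one' (t := (φ : DiffInterval)⁻¹ 1))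
  rwa [Diffeos.apply_inv_self] at this

theorem derivWithin_intervalFun_pos (φ : diffPlus) {t : ℝ} (ht : t ∈ Icc (0 : ℝ) 1) :
    0 < derivWithin (intervalFun φ) (Icc 0 1) t := by
  have hm : StrictMono (φ : DiffInterval) := φ.2
  have hmon : MonotoneOn (intervalFun φ) (Icc 0 1) := by
    intro s hs t ht hst
    rw [intervalFun_of_mem _ hs, intervalFun_of_mem _ ht]
    exact hm.monotone (show (⟨s, hs⟩ : unitInterval) ≤ ⟨t, ht⟩ from hst)
  exact lt_of_le_of_ne hmon.derivWithin_nonneg (derivWithin_intervalFun_ne_zero φ ht).symm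

/-! ### The quotient `φ t / t` -/

/-- The iterated derivatives of a diffeomorphism of `[0, 1]`. -/
def intervalDeriv (k : ℕ) (φ : DiffInterval) : ℝ → ℝ :=
  iteratedDerivWithin k (intervalFun φ) (Icc 0 1)

theorem isDerivFamily_intervalDeriv : IsDerivFamily 0 1 intervalDeriv :=
  IsDerivFamily.of_smoothFamilyAt zero_lt_one fun _ _ ht =>
    continuousAt_id.smoothFamilyAt_intervalFun ht

/-- The smooth function on `[0, 1]` with values `(φ t - φ 0) / t` for `t ≠ 0`. -/
def intervalQuotient (φ : DiffInterval) : ℝ → ℝ := IsDerivFamily.average intervalDeriv 0 φ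

theorem smoothFamilyAt_intervalQuotient (φ : DiffInterval) {t : ℝ} (ht : t ∈ Icc (0 : ℝ) 1) :
    SmoothFamilyAt intervalQuotient (Icc 0 1) φ t :=
  (isDerivFamily_intervalDeriv.isDerivFamily_average (by simp)).smoothFamilyAt zero_lt_one φ ht

theorem mul_intervalQuotient (φ : diffPlus) {t : ℝ} (ht : t ∈ Icc (0 : ℝ) 1) :
    t * intervalQuotient φ t = intervalFun φ t := by
  have h0 : (0 : ℝ) ∈ Icc (0 : ℝ) 1 := by simp
  have h1 := isDerivFamily_intervalDeriv.mul_average h0 (φ : DiffInterval) ht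
  have h2 : intervalFun φ 0 = 0 := by
    rw [intervalFun_of_mem _ h0]
    exact congrArg Subtype.val (diffPlus_apply_zero φ)
  simpa [intervalQuotient, intervalDeriv, h2] using h1

/-- At 0 the quotient is the derivative of `φ`, elsewhere it is `φ t / t`. Strict positivity,
including at 0, is what keeps the square root of the quotient smooth. -/
theorem intervalQuotient_pos (φ : diffPlus) {t : ℝ} (ht : t ∈ Icc (0 : ℝ) 1) :
    0 < intervalQuotient φ t := by
  rcases eq_or_lt_of_le ht.1 with rfl | hpos
  · have : intervalQuotient φ 0 = derivWithin (intervalFun φ) (Icc 0 1) 0 := by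
      simp [intervalQuotient, IsDerivFamily.average, intervalDeriv]
    rw [this]
    exact derivWithin_intervalFun_pos φ ht
  · have h1 := mul_intervalQuotient φ ht
    have hm : StrictMono (φ : DiffInterval) := φ.2
    have h2 : 0 < intervalFun φ t := by
      rw [intervalFun_of_mem _ ht]
      have := hm (show (0 : unitInterval) < ⟨t, ht⟩ from hpos)
      rw [diffPlus_apply_zero] at this
      exact this
    rw [← h1] at h2
    exact (pos_iff_pos_of_mul_pos h2).1 hpos

/-! ### Convex combinations with the identity -/

/-- Bootstrapping with `w' = 1 / u'(w)`: if `w` is of class `C^n`, then so is `w'`, hence `w` is of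
class `C^(n+1)`. -/
theorem contDiffOn_inverse_Icc {u w : ℝ → ℝ} (hu : ContDiffOn ℝ ∞ u (Icc 0 1))
    (hu' : ∀ t ∈ Icc (0 : ℝ) 1, derivWithin u (Icc 0 1) t ≠ 0) (hw : ContinuousOn w (Icc 0 1))
    (hmap : MapsTo w (Icc 0 1) (Icc 0 1)) (huw : ∀ t ∈ Icc (0 : ℝ) 1, u (w t) = t) :
    ContDiffOn ℝ ∞ w (Icc 0 1) := by
  have hU := uniqueDiffOn_Icc_zero_one
  have hder : ∀ t ∈ Icc (0 : ℝ) 1,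
      HasDerivWithinAt w (derivWithin u (Icc 0 1) (w t))⁻¹ (Icc 0 1) t := by
    intro t ht
    have h1 : HasDerivWithinAt u (derivWithin u (Icc 0 1) (w t)) (Icc 0 1) (w t) :=
      (hu.differentiableOn (by simp) _ (hmap ht)).hasDerivWithinAt
    have h2 : HasFDerivWithinAt u (ContinuousLinearEquiv.unitsEquivAut ℝ
      (Units.mk0 _ (hu' _ (hmap ht))) : ℝ →L[ℝ] ℝ) (Icc 0 1) (w t) := h1
    exact h2.of_local_left_inverse (tendsto_nhdsWithin_iff.2
      ⟨hw t ht, eventually_mem_nhdsWithin.mono hmap⟩) ht (eventually_mem_nhdsWithin.mono huw)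
  have hdw : EqOn (derivWithin w (Icc 0 1)) (fun t => (derivWithin u (Icc 0 1) (w t))⁻¹)
      (Icc 0 1) := fun t ht => (hder t ht).derivWithin (hU t ht)
  have hu1 : ContDiffOn ℝ ∞ (derivWithin u (Icc 0 1)) (Icc 0 1) :=
    ((contDiffOn_infty_iff_derivWithin hU).1 hu).2
  rw [contDiffOn_infty]
  intro n
  induction n with
  | zero => exact contDiffOn_zero.2 hw
  | succ n ih =>
    rw [show ((n + 1 : ℕ) : ℕ∞ω) = (n : ℕ∞ω) + 1 by norm_cast, contDiffOn_succ_iff_derivWithin hU]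
    refine ⟨fun t ht => (hder t ht).differentiableWithinAt, by simp, ContDiffOn.congr ?_ hdw⟩
    exact ((hu1.of_le (by exact_mod_cast le_top)).comp ih hmap).inv fun t ht => hu' _ (hmap ht)

theorem exists_diffPlus_of_deriv_pos {u : ℝ → ℝ} (hu : ContDiffOn ℝ ∞ u (Icc 0 1))
    (hu' : ∀ t ∈ Icc (0 : ℝ) 1, 0 < derivWithin u (Icc 0 1) t) (h0 : u 0 = 0) (h1 : u 1 = 1) :
    ∃ φ : diffPlus, ∀ t : unitInterval, ((φ : DiffInterval) t : ℝ) = u t := by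
  have hmono : StrictMonoOn u (Icc 0 1) := by
    refine strictMonoOn_of_deriv_pos (convex_Icc 0 1) hu.continuousOn fun t ht => ?_
    rw [← derivWithin_of_mem_nhds (mem_interior_iff_mem_nhds.1 ht)]
    exact hu' t (interior_subset ht)
  have hmap : MapsTo u (Icc 0 1) (Icc 0 1) := fun t ht => by
    constructor
    · rw [← h0]; exact hmono.monotoneOn (by simp) ht ht.1
    · rw [← h1]; exact hmono.monotoneOn ht (by simp) ht.2
  have hsurj : SurjOn u (Icc 0 1) (Icc 0 1) := by
    have := intermediate_value_Icc zero_le_one hu.continuousOn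
    rwa [h0, h1] at this
  let v : unitInterval → unitInterval := hmap.restrict u _ _
  have hv : StrictMono v := fun s t hst => hmono s.2 t.2 hst
  have hvs : Function.Surjective v := hmap.restrict_surjective_iff.2 hsurj
  let e : unitInterval ≃o unitInterval := hv.orderIsoOfSurjective v hvs
  have he : ∀ t, (e t : ℝ) = u t := fun t => rfl
  let w : ℝ → ℝ := fun t => e.symm (projIcc 0 1 zero_le_one t)
  have hw : Continuous w :=
    continuous_subtype_val.comp (e.symm.continuous.comp continuous_projIcc)
  have hwe : ∀ t : unitInterval, (e.symm t : ℝ) = w t := fun t => by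
    simp only [w, projIcc_val]
  have hws : ContDiffOn ℝ ∞ w (Icc 0 1) := by
    refine contDiffOn_inverse_Icc hu (fun t ht => (hu' t ht).ne') hw.continuousOn
      (fun t _ => (e.symm (projIcc 0 1 zero_le_one t)).2) fun t ht => ?_
    rw [← he, e.apply_symm_apply, projIcc_of_mem zero_le_one ht]
  refine ⟨⟨Diffeos.ofPerm e.toEquiv ⟨u, contMDiffOn_iff_contDiffOn.2 hu, he⟩
    ⟨w, contMDiffOn_iff_contDiffOn.2 hws, hwe⟩, hv⟩, he⟩

/-- Having a positive derivative and fixing both end points are convex conditions, and by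
`exists_diffPlus_of_deriv_pos` a smooth function on `[0, 1]` that meets them is an element of
`diffPlus`. -/
theorem exists_convexCombination (φ : diffPlus) (s : unitInterval) :
    ∃ ψ : diffPlus, ∀ t : unitInterval,
      ((ψ : DiffInterval) t : ℝ) = (1 - s) * (φ : DiffInterval) t + s * t := by
  have hz : (0 : ℝ) ∈ Icc (0 : ℝ) 1 := by simp
  have ho : (1 : ℝ) ∈ Icc (0 : ℝ) 1 := by simp
  refine (exists_diffPlus_of_deriv_pos
    (u := fun t => (1 - (s : ℝ)) * intervalFun φ t + s * t) ?_ ?_ ?_ ?_).imp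
    fun ψ hψ t => by rw [hψ t, intervalFun_coe]
  · exact (contDiffOn_const.mul (contDiffOn_intervalFun φ)).add
      (contDiffOn_const.mul contDiffOn_id)
  · intro t ht
    have h1 : HasDerivWithinAt (fun t => (1 - (s : ℝ)) * intervalFun φ t + s * t)
        ((1 - (s : ℝ)) * derivWithin (intervalFun φ) (Icc 0 1) t + s * 1) (Icc 0 1) t :=
      ((((contDiffOn_intervalFun φ).differentiableOn (by simp) t ht).hasDerivWithinAt).const_mul
        _).add ((hasDerivWithinAt_id t _).const_mul _)
    rw [h1.derivWithin (uniqueDiffOn_Icc_zero_one t ht)]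
    have hp := derivWithin_intervalFun_pos φ ht
    rcases eq_or_lt_of_le s.2.1 with h | h
    · rw [← h]; simpa using hp
    · have := mul_nonneg (sub_nonneg.2 s.2.2) hp.le
      linarith
  · rw [intervalFun_of_mem _ hz]
    have := congrArg Subtype.val (diffPlus_apply_zero φ)
    simp only [show (⟨0, hz⟩ : unitInterval) = 0 from rfl, this]
    simp
  · rw [intervalFun_of_mem _ ho]
    have := congrArg Subtype.val (diffPlus_apply_one φ)
    simp only [show (⟨1, ho⟩ : unitInterval) = 1 from rfl, this]
    simp

end Interval

/-! ### Calculus lemmas -/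

section Calculus

open Filter

/-- Moving from a regular point in a direction `w` with `L w < 0` stays in the sublevel set for
small times, so the tangent cone contains a nonempty open half-space, which spans. -/
theorem uniqueDiffWithinAt_of_sublevel {V : Type*} [NormedAddCommGroup V] [NormedSpace ℝ V]
    {u : V → ℝ} {L : V →L[ℝ] ℝ} {y v : V} {A : Set V} (hu : HasFDerivAt u L y) (hv : L v ≠ 0)
    (hA : ∀ z, u z ≤ u y → z ∈ A) : UniqueDiffWithinAt ℝ A y := by
  have hsub : {w | L w < 0} ⊆ tangentConeAt ℝ A y := by
    intro w hw
    have hd : HasDerivAt (fun t : ℝ => u (y + t • w)) (L w) 0 := by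
      have h1 : HasDerivAt (fun t : ℝ => y + t • w) w 0 := by
        simpa using ((hasDerivAt_id (0 : ℝ)).smul_const w).const_add y
      have h2 : HasFDerivAt u L (y + (0 : ℝ) • w) := by simpa using hu
      exact h2.comp_hasDerivAt _ h1
    have ht := hd.tendsto_slope_zero_right
    have hneg := ht.eventually_lt_const hw
    refine mem_tangentConeAt_of_add_smul_mem (l := 𝓝[>] (0 : ℝ)) (c := id)
      (tendsto_id'.2 (nhdsGT_le_nhdsNE 0)) ?_
    filter_upwards [hneg, self_mem_nhdsWithin] with t h1 (h2 : 0 < t)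
    refine hA _ ?_
    simp only [zero_add, zero_smul, add_zero, smul_eq_mul] at h1
    have h3 : u (y + t • w) - u y < 0 := by
      by_contra hc
      exact absurd h1 (not_lt.2 (mul_nonneg (inv_nonneg.2 h2.le) (not_lt.1 hc)))
    exact (sub_neg.1 h3).le
  refine ⟨?_, subset_closure (hA y le_rfl)⟩
  have hopen : IsOpen {w | L w < 0} := isOpen_lt L.continuous continuous_const
  have hne : ∃ w, L w < 0 := by
    rcases lt_or_gt_of_ne hv with h | h
    · exact ⟨v, h⟩
    · exact ⟨-v, by simpa using h⟩
  have htop : Submodule.span ℝ (tangentConeAt ℝ A y) = ⊤ := by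
    refine Submodule.eq_top_of_nonempty_interior' _ ?_
    obtain ⟨w, hw⟩ := hne
    exact ⟨w, mem_interior.2 ⟨_, hsub.trans Submodule.subset_span, hopen, hw⟩⟩
  rw [htop]
  exact dense_univ

/-- The second derivative at 0, computed from the right and from the left, is `2 * a` and `2 * b`.
-/
theorem eq_of_contDiff_of_eq_sq {q : ℝ → ℝ} (hq : ContDiff ℝ ∞ q) {a b : ℝ}
    (ha : ∀ t, 0 ≤ t → q t = t ^ 2 * a) (hb : ∀ t, t ≤ 0 → q t = t ^ 2 * b) : a = b := by
  have hd : Differentiable ℝ q := hq.differentiable (by simp)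
  have hd' : Differentiable ℝ (deriv q) :=
    ((contDiff_infty_iff_deriv.1 hq).2).differentiable (by simp)
  have key : ∀ (s : Set ℝ) (c : ℝ), UniqueDiffOn ℝ s → (0 : ℝ) ∈ s →
      (∀ t ∈ s, q t = t ^ 2 * c) → deriv (deriv q) 0 = 2 * c := by
    intro s c hs h0 hc
    have h1 : ∀ t ∈ s, deriv q t = 2 * t * c := by
      intro t ht
      have e1 : HasDerivWithinAt (fun t : ℝ => t ^ 2 * c) (2 * t * c) s t := by
        simpa using ((hasDerivAt_pow 2 t).mul_const c).hasDerivWithinAt (s := s)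
      have e2 := e1.congr (f := fun t : ℝ => t ^ 2 * c) (f₁ := q) hc (hc t ht)
      exact (hs t ht).eq_deriv _ (hd t).hasDerivAt.hasDerivWithinAt e2
    have e1 : HasDerivWithinAt (fun t : ℝ => 2 * t * c) (2 * c) s 0 := by
      simpa using (((hasDerivAt_id (0 : ℝ)).const_mul 2).mul_const c).hasDerivWithinAt (s := s)
    have e2 := e1.congr (f₁ := deriv q) h1 (h1 0 h0)
    exact (hs 0 h0).eq_deriv _ (hd' 0).hasDerivAt.hasDerivWithinAt e2
  have h1 := key (Ici 0) a (uniqueDiffOn_Ici 0) self_mem_Ici ha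
  have h2 := key (Iic 0) b (uniqueDiffOn_Iic 0) self_mem_Iic hb
  linarith

end Calculus

/-! ### Fiberwise multiplication in a vector bundle -/

section BundleSMul

open Filter

variable {B F : Type*} {E : B → Type*} [∀ b, AddCommGroup (E b)] [∀ b, Module ℝ (E b)]

/-- Multiplication of a vector of a bundle by a scalar. -/
def fiberSMul (c : ℝ) (x : TotalSpace F E) : TotalSpace F E := ⟨x.1, c • x.2⟩

@[simp] theorem fiberSMul_one (x : TotalSpace F E) : fiberSMul 1 x = x := by
  simp [fiberSMul]

theorem fiberSMul_fiberSMul (c d : ℝ) (x : TotalSpace F E) :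
    fiberSMul c (fiberSMul d x) = fiberSMul (c * d) x :=
  congrArg (TotalSpace.mk x.1) (smul_smul c d x.2)

variable {VB : Type*} [NormedAddCommGroup VB] [TopologicalSpace B] [ChartedSpace VB B]
  [NormedAddCommGroup F] [TopologicalSpace (TotalSpace F E)] [∀ b, TopologicalSpace (E b)]
  [FiberBundle F E]

/-- The preferred charts of the total space are defined over open sets of the base and contain whole
fibres, so scaling never leaves their domains. -/
theorem fiberSMul_mem_chartAt_source (y : TotalSpace F E) (c : ℝ) {x : TotalSpace F E}
    (hx : x ∈ (chartAt (ModelProd VB F) y).source) :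
    fiberSMul c x ∈ (chartAt (ModelProd VB F) y).source := by
  rw [FiberBundle.chartedSpace_chartAt] at hx ⊢
  simp only [mfld_simps] at hx ⊢
  have hb : x.proj ∈ (trivializationAt F E y.proj).baseSet :=
    (trivializationAt F E y.proj).mem_source.1 hx.1
  refine ⟨(trivializationAt F E y.proj).mem_source.2 hb, ?_⟩
  have h2 := hx.2
  rw [Trivialization.coe_fst' _ hb] at h2
  rw [Trivialization.coe_fst' _ (by exact hb)]
  exact h2

variable [NormedSpace ℝ VB] [NormedSpace ℝ F] [VectorBundle ℝ F E]

theorem trivializationAt_fiberSMul (b : B) (c : ℝ) {x : TotalSpace F E}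
    (hx : x.proj ∈ (trivializationAt F E b).baseSet) :
    (trivializationAt F E b (fiberSMul c x)).2 = c • (trivializationAt F E b x).2 :=
  ((trivializationAt F E b).linear ℝ hx).map_smul c x.2

theorem ContMDiffWithinAt.fiberSMul {EN : Type*} [NormedAddCommGroup EN] [NormedSpace ℝ EN]
    {HN : Type*} [TopologicalSpace HN] {J : ModelWithCorners ℝ EN HN} {N : Type*}
    [TopologicalSpace N] [ChartedSpace HN N] {u : N → ℝ} {v : N → TotalSpace F E} {s : Set N}
    {x₀ : N} (hu : ContMDiffWithinAt J 𝓘(ℝ) ∞ u s x₀)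
    (hv : ContMDiffWithinAt J (bundleModel VB F) ∞ v s x₀) :
    ContMDiffWithinAt J (bundleModel VB F) ∞ (fun x => fiberSMul (u x) (v x)) s x₀ := by
  have hv' := contMDiffWithinAt_totalSpace.1 hv
  refine contMDiffWithinAt_totalSpace.2 ⟨hv'.1, ?_⟩
  refine (hu.smul hv'.2).congr_of_eventuallyEq ?_
    (trivializationAt_fiberSMul _ _ (mem_baseSet_trivializationAt F E _))
  have hc : ContinuousWithinAt (fun x => (v x).proj) s x₀ := hv'.1.continuousWithinAt
  filter_upwards [hc ((trivializationAt F E (v x₀).proj).open_baseSet.mem_nhds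
    (mem_baseSet_trivializationAt F E _))] with x hx
  exact trivializationAt_fiberSMul _ _ hx

theorem contMDiff_fiberSMul_curve (x : TotalSpace F E) :
    ContMDiff 𝓘(ℝ) (bundleModel VB F) ∞ (fun t : ℝ => fiberSMul t x) := by
  intro t
  exact ContMDiffWithinAt.fiberSMul contMDiffAt_id.contMDiffWithinAt
    contMDiffAt_const.contMDiffWithinAt

theorem chartAt_extend_fiberSMul (y : TotalSpace F E) (c : ℝ) {x : TotalSpace F E}
    (hx : x ∈ (chartAt (ModelProd VB F) y).source) :
    (chartAt (ModelProd VB F) y).extend (bundleModel VB F) (fiberSMul c x) =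
      (((chartAt (ModelProd VB F) y).extend (bundleModel VB F) x).1,
        c • ((chartAt (ModelProd VB F) y).extend (bundleModel VB F) x).2) := by
  have hx' := hx
  rw [FiberBundle.chartedSpace_chartAt] at hx'
  simp only [mfld_simps] at hx'
  have hb : x.proj ∈ (trivializationAt F E y.proj).baseSet :=
    (trivializationAt F E y.proj).mem_source.1 hx'.1
  have h := FiberBundle.extChartAt (IB := 𝓘(ℝ, VB)) y
  rw [extChartAt] at h
  rw [h]
  simp only [mfld_simps]
  refine Prod.ext ?_ (trivializationAt_fiberSMul _ _ hb)
  simp only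
  rw [Trivialization.coe_fst' _ hb, Trivialization.coe_fst' _ (by exact hb)]
  rfl

end BundleSMul

/-! ### Geometry of the tube of a homogeneous definite function -/

section TubeGeometry

open Filter

section Algebra

variable {B F : Type*} {E : B → Type*} [∀ b, AddCommGroup (E b)] [∀ b, Module ℝ (E b)]
  {f : TotalSpace F E → ℝ}

theorem IsFiberwiseHomogeneous.apply_zero (hhom : IsFiberwiseHomogeneous 2 f) (b : B) :
    f ⟨b, 0⟩ = 0 := by
  have := hhom b 0 0 le_rfl
  simpa using this

theorem IsFiberwiseHomogeneous.nonneg (hhom : IsFiberwiseHomogeneous 2 f)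
    (hdef : IsFiberwiseDefinite f) (x : TotalSpace F E) : 0 ≤ f x := by
  obtain ⟨b, v⟩ := x
  by_cases hv : v = 0
  · rw [hv, hhom.apply_zero]
  · exact (hdef b v hv).le

theorem IsFiberwiseHomogeneous.mem_tube_iff (hhom : IsFiberwiseHomogeneous 2 f)
    (hdef : IsFiberwiseDefinite f) (x : TotalSpace F E) : x ∈ tube f ↔ f x ≤ 1 :=
  ⟨fun h => h.2, fun h => ⟨hhom.nonneg hdef x, h⟩⟩

theorem isClosed_tube {M : Type*} [TopologicalSpace M] {f : M → ℝ} (hf : Continuous f) :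
    IsClosed (tube f) :=
  isClosed_Icc.preimage hf

end Algebra

theorem locallyCompactSpace_tube {VB : Type*} [NormedAddCommGroup VB] [NormedSpace ℝ VB]
    [FiniteDimensional ℝ VB] {B : Type*} [TopologicalSpace B] [ChartedSpace VB B]
    {F : Type*} [NormedAddCommGroup F] [NormedSpace ℝ F] [FiniteDimensional ℝ F]
    {E : B → Type*} [TopologicalSpace (TotalSpace F E)] [∀ b, TopologicalSpace (E b)]
    [FiberBundle F E] {f : TotalSpace F E → ℝ} (hf : Continuous f) :
    LocallyCompactSpace (tube f) := by
  have : LocallyCompactSpace (ModelProd VB F) := inferInstanceAs (LocallyCompactSpace (VB × F))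
  have : LocallyCompactSpace (TotalSpace F E) :=
    ChartedSpace.locallyCompactSpace (ModelProd VB F) (TotalSpace F E)
  exact (isClosed_tube hf).isClosedEmbedding_subtypeVal.locallyCompactSpace

variable {VB : Type*} [NormedAddCommGroup VB] [NormedSpace ℝ VB]
  {B : Type*} [TopologicalSpace B] [ChartedSpace VB B]
  {F : Type*} [NormedAddCommGroup F] [NormedSpace ℝ F]
  {E : B → Type*} [TopologicalSpace (TotalSpace F E)] [∀ b, AddCommGroup (E b)]
  [∀ b, Module ℝ (E b)] [∀ b, TopologicalSpace (E b)] [FiberBundle F E] [VectorBundle ℝ F E]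
  {f : TotalSpace F E → ℝ}

/-- Homogeneity is assumed for nonnegative scalars only. Smoothness across the zero section forces
the values on the two halves of a line to match, so `f` is even; the evenness of the level functions
rests on this. -/
theorem IsFiberwiseHomogeneous.apply_fiberSMul (hhom : IsFiberwiseHomogeneous 2 f)
    (hf : ContMDiff (bundleModel VB F) 𝓘(ℝ) ∞ f) (c : ℝ) (x : TotalSpace F E) :
    f (fiberSMul c x) = c ^ 2 * f x := by
  have hpos : ∀ (c : ℝ) (x : TotalSpace F E), 0 ≤ c → f (fiberSMul c x) = c ^ 2 * f x :=
    fun c x hc => hhom x.1 x.2 c hc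
  have hneg : ∀ c : ℝ, c ≤ 0 → f (fiberSMul c x) = c ^ 2 * f (fiberSMul (-1) x) := by
    intro c hc
    have := hpos (-c) (fiberSMul (-1) x) (neg_nonneg.2 hc)
    rw [fiberSMul_fiberSMul] at this
    simpa using this
  have hq : ContDiff ℝ ∞ fun t : ℝ => f (fiberSMul t x) :=
    contMDiff_iff_contDiff.1 (hf.comp (contMDiff_fiberSMul_curve x))
  have heq := eq_of_contDiff_of_eq_sq hq (fun t => hpos t x) hneg
  rcases le_total 0 c with h | h
  · exact hpos c x h
  · rw [hneg c h, ← heq]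

theorem IsFiberwiseDefinite.exists_apply_eq_one [Nonempty B] [Nontrivial F]
    (hdef : IsFiberwiseDefinite f) (hhom : IsFiberwiseHomogeneous 2 f) :
    ∃ x : TotalSpace F E, f x = 1 := by
  obtain ⟨b⟩ := ‹Nonempty B›
  obtain ⟨w, hw⟩ := exists_ne (0 : F)
  let L := (trivializationAt F E b).continuousLinearEquivAt ℝ b
    (mem_baseSet_trivializationAt F E b)
  have hv : L.symm w ≠ 0 := by simpa using hw
  have hp := hdef b _ hv
  refine ⟨⟨b, (√(f ⟨b, L.symm w⟩))⁻¹ • L.symm w⟩, ?_⟩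
  rw [hhom b _ _ (inv_nonneg.2 (Real.sqrt_nonneg _)), inv_pow, Real.sq_sqrt hp.le,
    inv_mul_cancel₀ hp.ne']

/-- In a trivialization over a compact set `K` of the base, `f` is bounded below by some `m > 0` on
the unit sphere bundle; homogeneity then bounds the fibre norm on the part of `T` over `K`.
Compactness of `B` patches these local bounds together. -/
theorem isCompact_tube [FiniteDimensional ℝ VB] [CompactSpace B] [FiniteDimensional ℝ F]
    (hf : ContMDiff (bundleModel VB F) 𝓘(ℝ) ∞ f)
    (hhom : IsFiberwiseHomogeneous 2 f) (hdef : IsFiberwiseDefinite f) : IsCompact (tube f) := by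
  have : LocallyCompactSpace B := ChartedSpace.locallyCompactSpace VB B
  suffices h : ∃ C : Set (TotalSpace F E), IsCompact C ∧
      (fun x : TotalSpace F E => x.proj) ⁻¹' univ ∩ tube f ⊆ C by
    obtain ⟨C, hC, hsub⟩ := h
    rw [preimage_univ, univ_inter] at hsub
    exact hC.of_isClosed_subset (isClosed_tube hf.continuous) hsub
  refine isCompact_univ.induction_on (p := fun s : Set B => ∃ C : Set (TotalSpace F E),
    IsCompact C ∧ (fun x : TotalSpace F E => x.proj) ⁻¹' s ∩ tube f ⊆ C) ?_ ?_ ?_ ?_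
  · exact ⟨∅, isCompact_empty, by simp⟩
  · rintro s t hst ⟨C, hC, h⟩
    exact ⟨C, hC, fun x hx => h ⟨hst hx.1, hx.2⟩⟩
  · rintro s t ⟨C, hC, h⟩ ⟨D, hD, h'⟩
    refine ⟨C ∪ D, hC.union hD, fun x hx => ?_⟩
    rcases hx.1 with hs | ht
    · exact Or.inl (h ⟨hs, hx.2⟩)
    · exact Or.inr (h' ⟨ht, hx.2⟩)
  · intro b _
    set e := trivializationAt F E b with he
    obtain ⟨K, hKb, hKe, hK⟩ := local_compact_nhds
      (e.open_baseSet.mem_nhds (mem_baseSet_trivializationAt F E b))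
    have hsymm : ContinuousOn e.toOpenPartialHomeomorph.symm (K ×ˢ (univ : Set F)) :=
      e.toOpenPartialHomeomorph.continuousOn_symm.mono fun p hp => by
        rw [e.target_eq]
        exact ⟨hKe hp.1, mem_univ _⟩
    have hcf : ContinuousOn (fun p => f (e.toOpenPartialHomeomorph.symm p))
        (K ×ˢ Metric.sphere (0 : F) 1) :=
      hf.continuous.comp_continuousOn (hsymm.mono (prod_mono_right (subset_univ _)))
    have hzero : ∀ x : TotalSpace F E, x.proj ∈ K → x.2 = 0 → (e x).2 = 0 := by
      intro x hx h0
      have := (e.linear ℝ (hKe hx)).map_zero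
      rw [← h0] at this
      exact this
    obtain ⟨m, hm0, hm⟩ := (hK.prod (isCompact_sphere (0 : F) 1)).exists_forall_le' hcf (a := 0) (by
      rintro ⟨b', v⟩ ⟨hb', hv⟩
      have htar : (b', v) ∈ e.target := by
        rw [e.target_eq]
        exact ⟨hKe hb', mem_univ _⟩
      have hproj : (e.toOpenPartialHomeomorph.symm (b', v)).proj = b' := e.proj_symm_apply htar
      have happ : e (e.toOpenPartialHomeomorph.symm (b', v)) = (b', v) := e.apply_symm_apply htar
      refine hdef _ _ fun h0 => ?_
      have h1 := hzero (e.toOpenPartialHomeomorph.symm (b', v)) (by rw [hproj]; exact hb') h0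
      rw [happ] at h1
      simp only at h1
      simp only [h1] at hv
      simp at hv)
    -- The radius: for a nonzero vector of fibre norm `n`, normalizing gives `m ≤ f x / n ^ 2 ≤ 1 /
    -- n ^ 2`, hence `n ≤ √(1 / m)`.
    refine ⟨K, mem_nhdsWithin_of_mem_nhds hKb,
      e.toOpenPartialHomeomorph.symm '' (K ×ˢ Metric.closedBall (0 : F) √(1 / m)),
      (hK.prod (isCompact_closedBall _ _)).image_of_continuousOn
        (hsymm.mono (prod_mono_right (subset_univ _))), ?_⟩
    rintro x ⟨hxK, hxT⟩
    have hxK' : x.proj ∈ K := hxK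
    have hxs : x ∈ e.source := e.mem_source.2 (hKe hxK')
    refine ⟨e x, ⟨?_, ?_⟩, e.symm_apply_apply hxs⟩
    · rw [e.coe_fst hxs]
      exact hxK'
    rw [mem_closedBall_zero_iff]
    rcases eq_or_ne (e x).2 0 with h0 | h0
    · rw [h0, norm_zero]
      exact Real.sqrt_nonneg _
    have hn : 0 < ‖(e x).2‖ := norm_pos_iff.2 h0
    have hy := hm (e (fiberSMul ‖(e x).2‖⁻¹ x)) ⟨by
        rw [e.coe_fst' (by exact hKe hxK')]
        exact hxK', by
        rw [mem_sphere_zero_iff_norm, he, trivializationAt_fiberSMul _ _ (hKe hxK'), ← he,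
          norm_smul, norm_inv, norm_norm, inv_mul_cancel₀ hn.ne']⟩
    have hys : fiberSMul ‖(e x).2‖⁻¹ x ∈ e.source := e.mem_source.2 (hKe hxK')
    rw [e.symm_apply_apply hys, hhom.apply_fiberSMul hf] at hy
    have h1 : m ≤ (‖(e x).2‖⁻¹) ^ 2 := hy.trans
      (mul_le_of_le_one_right (sq_nonneg _) hxT.2)
    refine Real.le_sqrt_of_sq_le ?_
    rw [inv_pow] at h1
    rw [one_div]
    exact (le_inv_comm₀ hm0 (pow_pos hn 2)).1 h1

theorem fiberSMul_mem_tube (hf : ContMDiff (bundleModel VB F) 𝓘(ℝ) ∞ f)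
    (hhom : IsFiberwiseHomogeneous 2 f) (hdef : IsFiberwiseDefinite f) {x : TotalSpace F E}
    (hx : f x ≤ 1) {t : ℝ} (ht : t ∈ Icc (-1 : ℝ) 1) : fiberSMul t x ∈ tube f := by
  rw [hhom.mem_tube_iff hdef, hhom.apply_fiberSMul hf]
  exact mul_le_one₀ ((sq_le_one_iff_abs_le_one t).2 (abs_le.2 ht)) (hhom.nonneg hdef x) hx

/-- A ray through a vector of level 1 is a cross-section of `f`; reading `h` along it turns a
foliated diffeomorphism into a function of the level. -/
theorem exists_levelRay (hf : ContMDiff (bundleModel VB F) 𝓘(ℝ) ∞ f)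
    (hhom : IsFiberwiseHomogeneous 2 f) (hdef : IsFiberwiseDefinite f)
    {v : TotalSpace F E} (hv : f v = 1) :
    ∃ r : unitInterval → tube f, (∀ s, (r s : TotalSpace F E) = fiberSMul √(s : ℝ) v) ∧
      ∀ s, tubeMap f (r s) = s := by
  refine ⟨fun s => ⟨fiberSMul √(s : ℝ) v, fiberSMul_mem_tube hf hhom hdef hv.le
    ⟨by linarith [Real.sqrt_nonneg (s : ℝ)], Real.sqrt_le_one.2 s.2.2⟩⟩, fun s => rfl, fun s => ?_⟩
  apply Subtype.ext
  change f (fiberSMul √(s : ℝ) v) = s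
  rw [hhom.apply_fiberSMul hf, hv, mul_one, Real.sq_sqrt s.2.1]

theorem tubeMap_surjective [Nonempty B] [Nontrivial F]
    (hf : ContMDiff (bundleModel VB F) 𝓘(ℝ) ∞ f)
    (hhom : IsFiberwiseHomogeneous 2 f) (hdef : IsFiberwiseDefinite f) :
    Function.Surjective (tubeMap f) := by
  obtain ⟨v, hv⟩ := hdef.exists_apply_eq_one hhom
  obtain ⟨r, -, hr⟩ := exists_levelRay hf hhom hdef hv
  exact fun s => ⟨r s, hr s⟩

/-- Points with `f x < 1` have an open neighbourhood inside the tube. Boundary points are regular: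
along the radial curve `f` is `t ^ 2 * f x`, with derivative 2 at `t = 1`, so the sublevel criterion
applies in a chart. -/
theorem uniqueMDiffOn_tube [IsManifold 𝓘(ℝ, VB) ∞ B] [ContMDiffVectorBundle ∞ F E 𝓘(ℝ, VB)]
    (hf : ContMDiff (bundleModel VB F) 𝓘(ℝ) ∞ f)
    (hhom : IsFiberwiseHomogeneous 2 f) (hdef : IsFiberwiseDefinite f) :
    UniqueMDiffOn (bundleModel VB F) (tube f) := by
  intro x hx
  rcases lt_or_eq_of_le hx.2 with hlt | heq
  · have ho : IsOpen {y | f y < 1} := isOpen_lt hf.continuous continuous_const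
    exact (ho.uniqueMDiffWithinAt hlt).mono fun y hy => (hhom.mem_tube_iff hdef y).2 (le_of_lt hy)
  · have hmem := IsManifold.chart_mem_maximalAtlas (I := bundleModel VB F) (n := ∞) x
    have hxs := mem_chart_source (ModelProd VB F) x
    set χ := (chartAt (ModelProd VB F) x) with hχ
    have hu : ContDiffAt ℝ ∞ (f ∘ (χ.extend (bundleModel VB F)).symm)
        (χ.extend (bundleModel VB F) x) := hf.contMDiffAt.contDiffAt_comp_extend_symm hmem hxs
    have hL := (hu.differentiableAt (by simp)).hasFDerivAt
    have hc : ContDiffAt ℝ ∞ (fun t : ℝ => χ.extend (bundleModel VB F) (fiberSMul t x)) 1 := by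
      rw [← contMDiffAt_iff_contDiffAt]
      refine ContMDiffAt.comp (I' := bundleModel VB F) _ ?_
        (contMDiff_fiberSMul_curve x).contMDiffAt
      rw [fiberSMul_one]
      exact χ.contMDiffAt_extend hmem hxs
    have hc' := (hc.differentiableAt (by simp)).hasDerivAt
    have hcomp := HasFDerivAt.comp_hasDerivAt (1 : ℝ) (by rw [fiberSMul_one]; exact hL) hc'
    have hev : (fun t : ℝ => t ^ 2 * f x) =ᶠ[𝓝 1] ((f ∘ (χ.extend (bundleModel VB F)).symm) ∘
        fun t : ℝ => χ.extend (bundleModel VB F) (fiberSMul t x)) := by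
      refine Eventually.of_forall fun t => ?_
      simp only [Function.comp_apply]
      rw [χ.extend_left_inv (fiberSMul_mem_chartAt_source x t hxs), hhom.apply_fiberSMul hf]
    have h1 := (hcomp.congr_of_eventuallyEq hev).unique
      ((hasDerivAt_pow 2 (1 : ℝ)).mul_const (f x))
    have hne : ∀ z, (f ∘ (χ.extend (bundleModel VB F)).symm) z ≤
        (f ∘ (χ.extend (bundleModel VB F)).symm) (χ.extend (bundleModel VB F) x) →
        z ∈ (extChartAt (bundleModel VB F) x).symm ⁻¹' tube f ∩ range (bundleModel VB F) := by
      intro z hz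
      rw [ModelWithCorners.range_eq_univ, inter_univ]
      refine (hhom.mem_tube_iff hdef _).2 ?_
      simp only [Function.comp_apply] at hz
      rw [χ.extend_left_inv hxs, heq] at hz
      exact hz
    refine uniqueDiffWithinAt_of_sublevel
      (v := deriv (fun t : ℝ => χ.extend (bundleModel VB F) (fiberSMul t x)) 1) hL ?_ hne
    rw [h1, heq]
    norm_num

end TubeGeometry

/-! ### Smooth families of diffeomorphisms of the tube -/

section TubeFamilies

open Filter

variable {VB : Type*} [NormedAddCommGroup VB] [NormedSpace ℝ VB] [FiniteDimensional ℝ VB]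
  {B : Type*} [TopologicalSpace B] [ChartedSpace VB B] [IsManifold 𝓘(ℝ, VB) ∞ B]
  {F : Type*} [NormedAddCommGroup F] [NormedSpace ℝ F] [FiniteDimensional ℝ F]
  {E : B → Type*} [TopologicalSpace (TotalSpace F E)] [∀ b, AddCommGroup (E b)]
  [∀ b, Module ℝ (E b)] [∀ b, TopologicalSpace (E b)] [FiberBundle F E] [VectorBundle ℝ F E]
  [ContMDiffVectorBundle ∞ F E 𝓘(ℝ, VB)]
  {f : TotalSpace F E → ℝ} {X : Type*} [TopologicalSpace X]

/-- Multiplying a continuous family of diffeomorphisms of the tube by smooth functions of the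
levels gives a continuous family. -/
theorem continuous_of_eq_fiberSMul [CompactSpace B]
    (hf : ContMDiff (bundleModel VB F) 𝓘(ℝ) ∞ f)
    (hhom : IsFiberwiseHomogeneous 2 f) (hdef : IsFiberwiseDefinite f)
    {h g : X → DiffTube (bundleModel VB F) f} (hh : Continuous h) {c : X → ℝ → ℝ}
    (hc : ∀ ξ, ∀ t ∈ Icc (0 : ℝ) 1, SmoothFamilyAt c (Icc 0 1) ξ t)
    (hg : ∀ ξ (x : tube f), (g ξ x : TotalSpace F E) = fiberSMul (c ξ (f x)) (h ξ x : TotalSpace F E)) :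
    Continuous g := by
  have hU := uniqueMDiffOn_tube hf hhom hdef
  have : CompactSpace (tube f) := isCompact_iff_compactSpace.1 (isCompact_tube hf hhom hdef)
  have : LocallyCompactSpace (tube f) := locallyCompactSpace_tube (VB := VB) hf.continuous
  refine Diffeos.continuous_of_smoothInChartsAt (fun φ hφ => hU.uniqueDiffOn_chartDomain hφ)
    fun ξ₀ x₀ => ?_
  have hφ := IsManifold.chart_mem_maximalAtlas (I := bundleModel VB F) (n := ∞)
    (x₀ : TotalSpace F E)
  have hψ := IsManifold.chart_mem_maximalAtlas (I := bundleModel VB F) (n := ∞)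
    (h ξ₀ x₀ : TotalSpace F E)
  have hx := mem_chart_source (ModelProd VB F) (x₀ : TotalSpace F E)
  have hs := hh.continuousAt.smoothInChartsAt (ξ₀ := ξ₀) (x₀ := x₀) hφ hψ
    (hU.uniqueDiffOn_chartDomain hφ) hx (mem_chart_source (ModelProd VB F) _)
  have hu := hU.uniqueDiffOn_chartDomain hφ
  refine ⟨_, hφ, _, hψ, hx, ?_, ?_, ?_⟩
  · rw [hg]
    exact fiberSMul_mem_chartAt_source _ _ (mem_chart_source (ModelProd VB F) _)
  · filter_upwards [hs.eventually_mem] with p hp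
    rw [hg]
    exact fiberSMul_mem_chartAt_source _ _ hp
  · set φ := chartAt (ModelProd VB F) (x₀ : TotalSpace F E)
    set ψ := chartAt (ModelProd VB F) (h ξ₀ x₀ : TotalSpace F E)
    have hx' := mem_chartDomain (I := bundleModel VB F) x₀ hx
    have hsrc : ∀ᶠ p : X × tube f in 𝓝 (ξ₀, x₀), (p.2 : TotalSpace F E) ∈ φ.source := by
      rw [nhds_prod_eq]
      exact Eventually.prod_inr ((φ.open_source.preimage continuous_subtype_val).mem_nhds hx) _
    have hft : ContDiffAt ℝ ∞ (f ∘ (φ.extend (bundleModel VB F)).symm)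
        (φ.extend (bundleModel VB F) x₀) := hf.contMDiffAt.contDiffAt_comp_extend_symm hφ hx
    have f1 : SmoothFamilyAt (fun _ : X => f ∘ (φ.extend (bundleModel VB F)).symm)
        (chartDomain (bundleModel VB F) (tube f) φ) ξ₀ (φ.extend (bundleModel VB F) x₀) :=
      SmoothFamilyAt.const hu hx' hft.contDiffWithinAt
    have e1 : (f ∘ (φ.extend (bundleModel VB F)).symm) (φ.extend (bundleModel VB F) x₀) = f x₀ := by
      rw [Function.comp_apply, φ.extend_left_inv hx]
    have f2 := SmoothFamilyAt.comp (G := c) (S' := Icc 0 1) (by rw [e1]; exact hc ξ₀ _ x₀.2) f1 hu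
      uniqueDiffOn_Icc_zero_one hx' (by
        rw [prod_nhdsWithin_chartDomain φ ξ₀ hx, eventually_map]
        filter_upwards [hsrc] with p hp
        simp only [Function.comp_apply, φ.extend_left_inv hp]
        exact p.2.2)
    -- In the preferred charts scaling by `c` is `(b, w) ↦ (b, c • w)`, so the local representation
    -- of `g` is a fixed smooth map applied to the factor and to the local representation of `h`.
    have f3 := (f2.prodMk hs.smoothFamilyAt hu hx').comp_left
      (G := fun q : ℝ × (VB × F) => (q.2.1, q.1 • q.2.2)) hu hx'
      (ContDiff.contDiffAt (by fun_prop))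
    refine f3.congr hx' ?_
    rw [prod_nhdsWithin_chartDomain φ ξ₀ hx, eventually_map]
    filter_upwards [hsrc, hs.eventually_mem] with p hp hp'
    rw [(g p.1).localRep_apply _ hp, (h p.1).localRep_apply _ hp, hg,
      chartAt_extend_fiberSMul _ _ hp', Function.comp_apply, Function.comp_apply,
      φ.extend_left_inv hp]

/-- The values of `f` along the images of a diameter of the tube form a smooth family. -/
theorem smoothFamilyAt_apply_diameter (hf : ContMDiff (bundleModel VB F) 𝓘(ℝ) ∞ f)
    (hhom : IsFiberwiseHomogeneous 2 f) (hdef : IsFiberwiseDefinite f)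
    {h : X → DiffTube (bundleModel VB F) f} (hh : Continuous h) {v : TotalSpace F E}
    (hv : f v ≤ 1) (ξ₀ : X) {t₀ : ℝ} (ht₀ : t₀ ∈ Icc (-1 : ℝ) 1) :
    SmoothFamilyAt (fun ξ t => f (extendById (tube f) (h ξ).toPerm (fiberSMul t v)))
      (Icc (-1) 1) ξ₀ t₀ := by
  have hU := uniqueMDiffOn_tube hf hhom hdef
  have : LocallyCompactSpace (tube f) := locallyCompactSpace_tube (VB := VB) hf.continuous
  have hI := uniqueDiffOn_Icc (by norm_num : (-1 : ℝ) < 1)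
  have hmem : ∀ t ∈ Icc (-1 : ℝ) 1, fiberSMul t v ∈ tube f := fun t ht =>
    fiberSMul_mem_tube hf hhom hdef hv ht
  let x₀ : tube f := ⟨fiberSMul t₀ v, hmem t₀ ht₀⟩
  have hφ := IsManifold.chart_mem_maximalAtlas (I := bundleModel VB F) (n := ∞)
    (x₀ : TotalSpace F E)
  have hψ := IsManifold.chart_mem_maximalAtlas (I := bundleModel VB F) (n := ∞)
    (h ξ₀ x₀ : TotalSpace F E)
  have hx := mem_chart_source (ModelProd VB F) (x₀ : TotalSpace F E)
  have hy := mem_chart_source (ModelProd VB F) (h ξ₀ x₀ : TotalSpace F E)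
  have hu := hU.uniqueDiffOn_chartDomain hφ
  have hs := hh.continuousAt.smoothInChartsAt (ξ₀ := ξ₀) (x₀ := x₀) hφ hψ hu hx hy
  set φ := chartAt (ModelProd VB F) (x₀ : TotalSpace F E)
  set ψ := chartAt (ModelProd VB F) (h ξ₀ x₀ : TotalSpace F E)
  have hcurve := contMDiff_fiberSMul_curve (VB := VB) v
  have hc : ContDiffAt ℝ ∞ (fun t : ℝ => φ.extend (bundleModel VB F) (fiberSMul t v)) t₀ := by
    rw [← contMDiffAt_iff_contDiffAt]
    exact ContMDiffAt.comp (I' := bundleModel VB F) _ (φ.contMDiffAt_extend hφ hx)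
      hcurve.contMDiffAt
  have hsrc : ∀ᶠ t in 𝓝[Icc (-1) 1] t₀, fiberSMul t v ∈ φ.source ∧ t ∈ Icc (-1 : ℝ) 1 :=
    Eventually.and (mem_nhdsWithin_of_mem_nhds
      (hcurve.continuous.continuousAt (φ.open_source.mem_nhds hx))) eventually_mem_nhdsWithin
  have f1 : SmoothFamilyAt
      (fun (_ : X) (t : ℝ) => φ.extend (bundleModel VB F) (fiberSMul t v)) (Icc (-1) 1) ξ₀ t₀ :=
    SmoothFamilyAt.const hI ht₀ hc.contDiffWithinAt
  have f2 := SmoothFamilyAt.comp (G := fun ξ => (h ξ).localRep φ ψ)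
    (S' := chartDomain (bundleModel VB F) (tube f) φ) hs.smoothFamilyAt f1 hI hu ht₀
    ((hsrc.prod_inr (𝓝 ξ₀)).mono fun p hp => mem_chartDomain (I := bundleModel VB F)
      (⟨_, hmem p.2 hp.2⟩ : tube f) hp.1)
  have f3 := f2.comp_left (G := f ∘ (ψ.extend (bundleModel VB F)).symm) hI ht₀ (by
    have e := (h ξ₀).localRep_apply ψ hx
    rw [Function.comp_apply]
    erw [e]
    exact hf.contMDiffAt.contDiffAt_comp_extend_symm hψ hy)
  refine f3.congr ht₀ ?_
  have hev : ∀ᶠ p : X × ℝ in 𝓝 ξ₀ ×ˢ 𝓝[Icc (-1) 1] t₀,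
      extendById (tube f) (h p.1).toPerm (fiberSMul p.2 v) ∈ ψ.source := by
    have hle : (-1 : ℝ) ≤ 1 := by norm_num
    -- Clamping the parameter to `[-1, 1]` gives a continuous map from `ℝ` into the tube, through
    -- which the chart condition on pairs in `X × tube f` is pulled back.
    let r : ℝ → tube f := fun t => ⟨fiberSMul (projIcc (-1) 1 hle t : ℝ) v,
      hmem _ (projIcc (-1) 1 hle t).2⟩
    have hr : Continuous r := (hcurve.continuous.comp
      (continuous_subtype_val.comp continuous_projIcc)).subtype_mk _
    have hr' : ∀ t ∈ Icc (-1 : ℝ) 1, (r t : TotalSpace F E) = fiberSMul t v := fun t ht => by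
      simp only [r, projIcc_of_mem hle ht]
    have hr0 : r t₀ = x₀ := Subtype.ext (hr' t₀ ht₀)
    have ht : Tendsto (fun p : X × ℝ => (p.1, r p.2)) (𝓝 ξ₀ ×ˢ 𝓝[Icc (-1) 1] t₀)
        (𝓝 (ξ₀, x₀)) := by
      rw [nhds_prod_eq, ← hr0]
      exact tendsto_fst.prodMk ((hr.continuousAt.tendsto.mono_left nhdsWithin_le_nhds).comp
        tendsto_snd)
    filter_upwards [ht.eventually hs.eventually_mem, hsrc.prod_inr (𝓝 ξ₀)] with p hp hp'
    rw [← hr' p.2 hp'.2, extendById_apply]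
    exact hp
  filter_upwards [hsrc.prod_inr (𝓝 ξ₀), hev] with p hp hp'
  have e := (h p.1).localRep_apply (x := ⟨_, hmem p.2 hp.2⟩) ψ hp.1
  simp only [Function.comp_apply]
  simp only at e
  rw [e, ← extendById_apply, ψ.extend_left_inv hp']

end TubeFamilies

/-! ### The action of foliated diffeomorphisms on the set of levels -/

section Levels

open Filter

section General

variable {V : Type*} [NormedAddCommGroup V] [NormedSpace ℝ V]
  {H : Type*} [TopologicalSpace H] {I : ModelWithCorners ℝ V H}
  {M : Type*} [TopologicalSpace M] [ChartedSpace H M] {f : M → ℝ}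

theorem foliatedDiffeos_tubeMap_eq {h : DiffTube I f} (hh : h ∈ foliatedDiffeos I f)
    {x y : tube f} (hxy : tubeMap f x = tubeMap f y) : tubeMap f (h x) = tubeMap f (h y) := by
  obtain ⟨s, hs⟩ := hh _ ⟨tubeMap f x, rfl⟩
  have hx : h x ∈ leaf f s := by
    rw [hs]
    exact mem_image_of_mem _ rfl
  have hy : h y ∈ leaf f s := by
    rw [hs]
    exact mem_image_of_mem _ hxy.symm
  exact Eq.trans hx (Eq.symm hy)

theorem mem_leafPreservingDiffeos_iff {h : DiffTube I f} :
    h ∈ leafPreservingDiffeos I f ↔ ∀ x, tubeMap f (h x) = tubeMap f x := by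
  constructor
  · intro hh x
    have h1 : h x ∈ h '' leaf f (tubeMap f x) := mem_image_of_mem _ rfl
    rw [hh _ ⟨_, rfl⟩] at h1
    exact h1
  · rintro hh _ ⟨t, rfl⟩
    refine Subset.antisymm ?_ fun y hy => ⟨h⁻¹ y, ?_, h.apply_inv_self y⟩
    · rintro _ ⟨x, hx, rfl⟩
      exact (hh x).trans hx
    · have := hh (h⁻¹ y)
      rw [h.apply_inv_self] at this
      exact this.symm.trans hy

theorem mem_stabR_iff {h : DiffTube I f} :
    h ∈ stabR I f ↔ ∀ x, tubeMap f (h x) = tubeMap f x := by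
  constructor
  · intro hh x
    have := congrFun hh (h x)
    simp only [Function.comp_apply, Diffeos.inv_apply_self] at this
    exact this.symm
  · intro hh
    funext x
    have := hh (h⁻¹ x)
    rw [h.apply_inv_self] at this
    exact this.symm

theorem mem_foliatedDiffeos_of_semiconj {h : DiffTube I f}
    {φ : DiffInterval} (hφ : ∀ x, φ (tubeMap f x) = tubeMap f (h x)) :
    h ∈ foliatedDiffeos I f := by
  rintro _ ⟨t, rfl⟩
  refine ⟨φ t, Subset.antisymm (fun y hy => ⟨h⁻¹ y, ?_, h.apply_inv_self y⟩) ?_⟩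
  · have h1 := hφ (h⁻¹ y)
    rw [h.apply_inv_self] at h1
    have h2 : tubeMap f y = φ t := hy
    rw [h2] at h1
    exact φ.toPerm.injective h1
  · rintro _ ⟨x, hx, rfl⟩
    have hx' : tubeMap f x = t := hx
    exact (hφ x).symm.trans (by rw [hx'])

end General

variable {VB : Type*} [NormedAddCommGroup VB] [NormedSpace ℝ VB]
  {B : Type*} [TopologicalSpace B] [ChartedSpace VB B] [IsManifold 𝓘(ℝ, VB) ∞ B]
  {F : Type*} [NormedAddCommGroup F] [NormedSpace ℝ F]
  {E : B → Type*} [TopologicalSpace (TotalSpace F E)] [∀ b, AddCommGroup (E b)]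
  [∀ b, Module ℝ (E b)] [∀ b, TopologicalSpace (E b)] [FiberBundle F E] [VectorBundle ℝ F E]
  [ContMDiffVectorBundle ∞ F E 𝓘(ℝ, VB)]
  {f : TotalSpace F E → ℝ}

/-- A foliated diffeomorphism of the tube induces a diffeomorphism of the set `[0, 1]` of levels,
which depends continuously on it. -/
theorem exists_levelDiffeo [FiniteDimensional ℝ VB] [FiniteDimensional ℝ F] [Nonempty B] [Nontrivial F]
    (hf : ContMDiff (bundleModel VB F) 𝓘(ℝ) ∞ f)
    (hhom : IsFiberwiseHomogeneous 2 f) (hdef : IsFiberwiseDefinite f) :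
    ∃ σ : foliatedDiffeos (bundleModel VB F) f → DiffInterval, Continuous σ ∧
      ∀ (h : foliatedDiffeos (bundleModel VB F) f) (x : tube f),
        σ h (tubeMap f x) = tubeMap f ((h : DiffTube (bundleModel VB F) f) x) := by
  obtain ⟨v, hv⟩ := hdef.exists_apply_eq_one hhom
  obtain ⟨r, hrv, hr⟩ := exists_levelRay hf hhom hdef hv
  have hdiam := IsDerivFamily.of_smoothFamilyAt (X := foliatedDiffeos (bundleModel VB F) f)
    (by norm_num : (-1 : ℝ) < 1) (fun h t ht => smoothFamilyAt_apply_diameter hf hhom hdef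
      (continuous_subtype_val (p := fun h => h ∈ foliatedDiffeos (bundleModel VB F) f))
      hv.le h ht)
  -- The vectors `t v` and `-t v` lie on one leaf and `h` sends them to one leaf, so `f ∘ h` is even
  -- along the diameter. Substituting `t = √s` is then smooth up to `s = 0`, with parameter `h`.
  obtain ⟨d, hd, hd0⟩ := hdiam.exists_comp_sqrt (by
    intro h t ht
    have hmem : ∀ t ∈ Icc (-1 : ℝ) 1, fiberSMul t v ∈ tube f := fun t ht =>
      fiberSMul_mem_tube hf hhom hdef hv.le ht
    have ht' : -t ∈ Icc (-1 : ℝ) 1 := ⟨neg_le_neg ht.2, by linarith [ht.1]⟩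
    simp only [iteratedDerivWithin_zero]
    have e1 := extendById_apply (h : DiffTube (bundleModel VB F) f).toPerm
      (⟨_, hmem t ht⟩ : tube f)
    have e2 := extendById_apply (h : DiffTube (bundleModel VB F) f).toPerm
      (⟨_, hmem (-t) ht'⟩ : tube f)
    simp only at e1 e2
    rw [e1, e2]
    refine congrArg Subtype.val (foliatedDiffeos_tubeMap_eq h.2 (x := ⟨_, hmem (-t) ht'⟩)
      (y := ⟨_, hmem t ht⟩) (Subtype.ext ?_))
    change f (fiberSMul (-t) v) = f (fiberSMul t v)
    rw [hhom.apply_fiberSMul hf, hhom.apply_fiberSMul hf, neg_sq])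
  have hdr : ∀ (h : foliatedDiffeos (bundleModel VB F) f) (s : unitInterval),
      (tubeMap f ((h : DiffTube (bundleModel VB F) f) (r s)) : ℝ) = d 0 h s := by
    intro h s
    simp only [hd0, iteratedDerivWithin_zero]
    rw [← hrv s, extendById_apply]
    rfl
  let e : foliatedDiffeos (bundleModel VB F) f → Equiv.Perm unitInterval := fun h =>
    { toFun := fun s => tubeMap f ((h : DiffTube (bundleModel VB F) f) (r s))
      invFun := fun s => tubeMap f ((h⁻¹ : DiffTube (bundleModel VB F) f) (r s))
      left_inv := fun s => by
        have := foliatedDiffeos_tubeMap_eq (h⁻¹).2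
          (hr (tubeMap f ((h : DiffTube (bundleModel VB F) f) (r s))))
        refine this.trans ?_
        rw [Subgroup.coe_inv, Diffeos.inv_apply_self, hr]
      right_inv := fun s => by
        have := foliatedDiffeos_tubeMap_eq h.2
          (hr (tubeMap f ((h⁻¹ : DiffTube (bundleModel VB F) f) (r s))))
        refine this.trans ?_
        rw [Diffeos.apply_inv_self, hr] }
  have hsm : ∀ h, ContMDiffOn 𝓘(ℝ) 𝓘(ℝ) ∞ (d 0 h) unitInterval := fun h =>
    contMDiffOn_iff_contDiffOn.2 (hd.contDiffOn zero_lt_one h)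
  -- The inverse needs no inverse function argument: it is the level map of `h⁻¹`, smooth for the
  -- same reason.
  let σ : foliatedDiffeos (bundleModel VB F) f → DiffInterval := fun h =>
    Diffeos.ofPerm (e h) ⟨d 0 h, hsm h, hdr h⟩ ⟨d 0 h⁻¹, hsm h⁻¹, hdr h⁻¹⟩
  have hσ : ∀ h s, σ h s = tubeMap f ((h : DiffTube (bundleModel VB F) f) (r s)) :=
    fun h s => rfl
  refine ⟨σ, DiffInterval.continuous_of_smoothFamilyAt fun h t ht => ?_, fun h x => ?_⟩
  · refine (hd.smoothFamilyAt zero_lt_one h ht).congr ht ?_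
    have hmem : ∀ᶠ p : foliatedDiffeos (bundleModel VB F) f × ℝ in
        𝓝 h ×ˢ 𝓝[Icc (0 : ℝ) 1] t, p.2 ∈ Icc (0 : ℝ) 1 :=
      (eventually_mem_nhdsWithin (a := t) (s := Icc (0 : ℝ) 1)).prod_inr _
    filter_upwards [hmem] with p hp
    rw [intervalFun_of_mem _ hp, hσ]
    exact hdr p.1 ⟨p.2, hp⟩
  · rw [hσ]
    exact foliatedDiffeos_tubeMap_eq h.2 (hr _)

/-- A diffeomorphism of the set of levels induced by a diffeomorphism of the tube fixes the
critical level. -/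
theorem levelDiffeo_apply_zero_ne_one [Nonempty B]
    (hf : ContMDiff (bundleModel VB F) 𝓘(ℝ) ∞ f)
    (hhom : IsFiberwiseHomogeneous 2 f) (hdef : IsFiberwiseDefinite f)
    {φ : DiffInterval} {h : DiffTube (bundleModel VB F) f}
    (hφ : ∀ x, φ (tubeMap f x) = tubeMap f (h x)) : φ 0 ≠ 1 := by
  intro h01
  obtain ⟨b⟩ := ‹Nonempty B›
  have hz0 : f ⟨b, 0⟩ = 0 := hhom.apply_zero b
  let z : tube f := ⟨⟨b, 0⟩, (hhom.mem_tube_iff hdef _).2 (by rw [hz0]; exact zero_le_one)⟩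
  have hfw : f (h z : TotalSpace F E) = 1 := by
    have h1 := hφ z
    rw [show tubeMap f z = 0 from Subtype.ext hz0, h01] at h1
    exact (congrArg Subtype.val h1).symm
  have hmem : ∀ t ∈ Icc (0 : ℝ) 1, fiberSMul t (h z : TotalSpace F E) ∈ tube f := fun t ht =>
    fiberSMul_mem_tube hf hhom hdef hfw.le ⟨by linarith [ht.1], ht.2⟩
  have hχ := IsManifold.chart_mem_maximalAtlas (I := bundleModel VB F) (n := ∞)
    (z : TotalSpace F E)
  have hzs := mem_chart_source (ModelProd VB F) (z : TotalSpace F E)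
  set χ := chartAt (ModelProd VB F) (z : TotalSpace F E)
  -- If `φ 0 = 1`, the zero vector `z` is sent to the boundary. The curve `γ` is the preimage under
  -- `h` of the radial segment ending at `h z`, and the derivative of `f ∘ γ` at `t = 1` is computed
  -- in two ways.
  let γ : ℝ → TotalSpace F E := fun t =>
    extendById (tube f) (h⁻¹ : DiffTube (bundleModel VB F) f).toPerm
      (fiberSMul t (h z : TotalSpace F E))
  have h1mem : (1 : ℝ) ∈ Icc (0 : ℝ) 1 := by simp
  have hγ1 : γ 1 = z := by
    simp only [γ, fiberSMul_one]
    rw [extendById_apply, Diffeos.inv_apply_self]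
  have hγ : ContMDiffWithinAt 𝓘(ℝ) (bundleModel VB F) ∞ γ (Icc 0 1) 1 :=
    ((h⁻¹ : DiffTube (bundleModel VB F) f).contMDiffOn_extendById _ (hmem 1 h1mem)).comp 1
      (contMDiff_fiberSMul_curve (h z : TotalSpace F E)).contMDiffAt.contMDiffWithinAt hmem
  have hχγ : ContDiffWithinAt ℝ ∞ (fun t => χ.extend (bundleModel VB F) (γ t)) (Icc 0 1) 1 := by
    rw [← contMDiffWithinAt_iff_contDiffWithinAt]
    refine ContMDiffAt.comp_contMDiffWithinAt (I' := bundleModel VB F) _ ?_ hγ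
    rw [hγ1]
    exact χ.contMDiffAt_extend hχ hzs
  have hu : ContDiffAt ℝ ∞ (f ∘ (χ.extend (bundleModel VB F)).symm)
      (χ.extend (bundleModel VB F) z) := hf.contMDiffAt.contDiffAt_comp_extend_symm hχ hzs
  -- First value: `f` attains its minimum at `z = γ 1`, so its derivative there vanishes and the
  -- chain rule gives 0.
  have hmin : IsLocalMin (f ∘ (χ.extend (bundleModel VB F)).symm)
      (χ.extend (bundleModel VB F) z) := by
    refine Eventually.of_forall fun y => ?_
    rw [Function.comp_apply, χ.extend_left_inv hzs, Function.comp_apply]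
    exact hz0.le.trans (hhom.nonneg hdef _)
  have hL := (hu.differentiableAt (by simp)).hasFDerivAt
  rw [hmin.fderiv_eq_zero] at hL
  have hcomp := HasFDerivAt.comp_hasDerivWithinAt (1 : ℝ) (by rw [hγ1]; exact hL)
    (hχγ.differentiableWithinAt (by simp)).hasDerivWithinAt
  have hsq : HasDerivWithinAt (fun t : ℝ => t ^ 2) 2 (Icc 0 1) 1 := by
    simpa using (hasDerivAt_pow 2 (1 : ℝ)).hasDerivWithinAt (s := Icc (0 : ℝ) 1)
  have hsqm : MapsTo (fun t : ℝ => t ^ 2) (Icc 0 1) (Icc 0 1) := fun t ht =>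
    ⟨sq_nonneg t, pow_le_one₀ ht.1 ht.2⟩
  have hφd : HasDerivWithinAt (intervalFun φ⁻¹)
      (derivWithin (intervalFun φ⁻¹) (Icc 0 1) ((1 : ℝ) ^ 2)) (Icc 0 1) ((1 : ℝ) ^ 2) :=
    ((contDiffOn_intervalFun φ⁻¹).differentiableOn (by simp) _ (by simp)).hasDerivWithinAt
  have hcomp2 := HasDerivWithinAt.comp (h := fun t : ℝ => t ^ 2) (1 : ℝ) hφd hsq hsqm
  -- Second value: the level of `γ t` is `φ⁻¹ (t ^ 2)`, whose derivative at 1 is twice that of the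
  -- diffeomorphism `φ⁻¹`, which is not 0.
  have hlevel : ∀ t ∈ Icc (0 : ℝ) 1, f (γ t) = intervalFun φ⁻¹ (t ^ 2) := by
    intro t ht
    have e1 : γ t = (h⁻¹ : DiffTube (bundleModel VB F) f) ⟨_, hmem t ht⟩ :=
      extendById_apply _ (⟨_, hmem t ht⟩ : tube f)
    have e2 := hφ ((h⁻¹ : DiffTube (bundleModel VB F) f) ⟨_, hmem t ht⟩)
    rw [Diffeos.apply_inv_self] at e2
    have e3 : tubeMap f ⟨_, hmem t ht⟩ = ⟨t ^ 2, hsqm ht⟩ := Subtype.ext (by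
      change f (fiberSMul t (h z : TotalSpace F E)) = t ^ 2
      rw [hhom.apply_fiberSMul hf, hfw, mul_one])
    rw [e1, intervalFun_of_mem _ (hsqm ht), ← e3, ← e2, Diffeos.inv_apply_self]
    rfl
  have hev : ∀ t ∈ Icc (0 : ℝ) 1, γ t ∈ χ.source → (intervalFun φ⁻¹ ∘ fun t : ℝ => t ^ 2) t =
      ((f ∘ (χ.extend (bundleModel VB F)).symm) ∘
        fun t => χ.extend (bundleModel VB F) (γ t)) t := by
    intro t ht hγt
    simp only [Function.comp_apply]
    rw [χ.extend_left_inv hγt, hlevel t ht]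
  have hγsrc : ∀ᶠ t in 𝓝[Icc (0 : ℝ) 1] 1, γ t ∈ χ.source :=
    hγ.continuousWithinAt (χ.open_source.mem_nhds (by rw [hγ1]; exact hzs))
  have hcomp3 := hcomp2.congr_of_eventuallyEq (f₁ := (f ∘ (χ.extend (bundleModel VB F)).symm) ∘
        fun t => χ.extend (bundleModel VB F) (γ t)) (by
      filter_upwards [hγsrc, self_mem_nhdsWithin] with t h1 h2
      exact (hev t h2 h1).symm) (hev 1 h1mem (by rw [hγ1]; exact hzs)).symm
  have h0 := (uniqueDiffOn_Icc_zero_one 1 h1mem).eq_deriv _ hcomp3 hcomp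
  have hne := derivWithin_intervalFun_ne_zero φ⁻¹ (t := (1 : ℝ) ^ 2) (by simp)
  simp only [zero_apply] at h0
  exact hne (by linarith)

/-- A continuous injection of an interval is strictly monotone in one of the two senses; a
decreasing bijection of `[0, 1]` would send 0 to 1. -/
theorem strictMono_levelDiffeo [Nonempty B]
    (hf : ContMDiff (bundleModel VB F) 𝓘(ℝ) ∞ f)
    (hhom : IsFiberwiseHomogeneous 2 f) (hdef : IsFiberwiseDefinite f)
    {φ : DiffInterval} {h : DiffTube (bundleModel VB F) f}
    (hφ : ∀ x, φ (tubeMap f x) = tubeMap f (h x)) : StrictMono φ := by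
  have hc : Continuous φ := φ.continuous_apply.subtype_mk _
  refine (hc.strictMono_of_inj_boundedOrder' φ.toPerm.injective).resolve_right fun hanti => ?_
  refine levelDiffeo_apply_zero_ne_one hf hhom hdef hφ ?_
  refine le_antisymm unitInterval.le_one' ?_
  have := hanti.antitone (unitInterval.nonneg' (t := φ⁻¹ 1))
  rwa [Diffeos.apply_inv_self] at this

end Levels

/-! ### Radial diffeomorphisms of the tube -/

section Radial

open Filter

variable {VB : Type*} [NormedAddCommGroup VB] [NormedSpace ℝ VB]
  {B : Type*} [TopologicalSpace B] [ChartedSpace VB B]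
  {F : Type*} [NormedAddCommGroup F] [NormedSpace ℝ F]
  {E : B → Type*} [TopologicalSpace (TotalSpace F E)] [∀ b, AddCommGroup (E b)]
  [∀ b, Module ℝ (E b)] [∀ b, TopologicalSpace (E b)] [FiberBundle F E] [VectorBundle ℝ F E]
  {f : TotalSpace F E → ℝ}

/-- On a half-line through a nonzero vector `f` is a positive multiple of `c ^ 2`, hence injective.
Equalities between radial maps thereby reduce to equalities of levels. -/
theorem fiberSMul_eq_of_apply_eq (hf : ContMDiff (bundleModel VB F) 𝓘(ℝ) ∞ f)
    (hhom : IsFiberwiseHomogeneous 2 f) (hdef : IsFiberwiseDefinite f) {c d : ℝ}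
    (hc : 0 ≤ c) (hd : 0 ≤ d) {x : TotalSpace F E}
    (h : f (fiberSMul c x) = f (fiberSMul d x)) : fiberSMul c x = fiberSMul d x := by
  obtain ⟨b, v⟩ := x
  by_cases hv : v = 0
  · simp [fiberSMul, hv]
  · rw [hhom.apply_fiberSMul hf, hhom.apply_fiberSMul hf] at h
    have := mul_right_cancel₀ (hdef b v hv).ne' h
    rw [(pow_left_inj₀ hc hd two_ne_zero).1 this]

theorem apply_fiberSMul_sqrt_intervalQuotient (hf : ContMDiff (bundleModel VB F) 𝓘(ℝ) ∞ f)
    (hhom : IsFiberwiseHomogeneous 2 f) (φ : diffPlus) (x : tube f) :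
    f (fiberSMul √(intervalQuotient φ (f x)) x) = (φ : DiffInterval) (tubeMap f x) := by
  rw [hhom.apply_fiberSMul hf, Real.sq_sqrt (intervalQuotient_pos φ x.2).le, mul_comm,
    mul_intervalQuotient φ x.2]
  exact intervalFun_coe _ (tubeMap f x)

theorem contMDiffOn_fiberSMul_sqrt_intervalQuotient [IsManifold 𝓘(ℝ, VB) ∞ B]
    [ContMDiffVectorBundle ∞ F E 𝓘(ℝ, VB)] (hf : ContMDiff (bundleModel VB F) 𝓘(ℝ) ∞ f)
    (φ : diffPlus) :
    ContMDiffOn (bundleModel VB F) (bundleModel VB F) ∞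
      (fun x => fiberSMul √(intervalQuotient φ (f x)) x) (tube f) := by
  intro x hx
  have h1 : ContDiffWithinAt ℝ ∞ (fun t => √(intervalQuotient φ t)) (Icc 0 1) (f x) :=
    ((smoothFamilyAt_intervalQuotient φ hx).contDiffWithinAt hx).sqrt
      (intervalQuotient_pos φ hx).ne'
  exact ContMDiffWithinAt.fiberSMul
    (h1.contMDiffWithinAt.comp x hf.contMDiffAt.contMDiffWithinAt fun y hy => hy)
    contMDiffWithinAt_id

theorem exists_radialDiffeo [IsManifold 𝓘(ℝ, VB) ∞ B] [ContMDiffVectorBundle ∞ F E 𝓘(ℝ, VB)]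
    (hf : ContMDiff (bundleModel VB F) 𝓘(ℝ) ∞ f)
    (hhom : IsFiberwiseHomogeneous 2 f) (hdef : IsFiberwiseDefinite f) (φ : diffPlus) :
    ∃ g : DiffTube (bundleModel VB F) f,
      ∀ x, (g x : TotalSpace F E) = fiberSMul √(intervalQuotient φ (f x)) x := by
  let r : diffPlus → tube f → tube f := fun φ x => ⟨fiberSMul √(intervalQuotient φ (f x)) x, by
    rw [hhom.mem_tube_iff hdef, apply_fiberSMul_sqrt_intervalQuotient hf hhom]
    exact ((φ : DiffInterval) (tubeMap f x)).2.2⟩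
  have hr : ∀ φ x, tubeMap f (r φ x) = (φ : DiffInterval) (tubeMap f x) := fun φ x =>
    Subtype.ext (apply_fiberSMul_sqrt_intervalQuotient hf hhom φ x)
  -- Both sides are nonnegative multiples of `x`, so it suffices that the level of `x` is restored.
  have hinv : ∀ φ ψ : diffPlus, ψ * φ = 1 → ∀ x, r ψ (r φ x) = x := by
    intro φ ψ h x
    have h1 : tubeMap f (r ψ (r φ x)) = tubeMap f x := by
      rw [hr, hr, ← Diffeos.mul_apply, ← Subgroup.coe_mul, h]
      rfl
    apply Subtype.ext
    have h2 : (r ψ (r φ x) : TotalSpace F E) = fiberSMul (√(intervalQuotient ψ (f (r φ x))) *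
        √(intervalQuotient φ (f x))) x := fiberSMul_fiberSMul _ _ _
    rw [h2, ← fiberSMul_one (x : TotalSpace F E), fiberSMul_fiberSMul, mul_one]
    refine fiberSMul_eq_of_apply_eq hf hhom hdef (by positivity) zero_le_one ?_
    rw [fiberSMul_one, ← h2]
    exact congrArg Subtype.val h1
  exact ⟨Diffeos.ofPerm ⟨r φ, r φ⁻¹, hinv _ _ (inv_mul_cancel φ), hinv _ _ (mul_inv_cancel φ)⟩
    ⟨_, contMDiffOn_fiberSMul_sqrt_intervalQuotient hf φ, fun x => rfl⟩
    ⟨_, contMDiffOn_fiberSMul_sqrt_intervalQuotient hf φ⁻¹, fun x => rfl⟩, fun x => rfl⟩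

variable [FiniteDimensional ℝ VB] [FiniteDimensional ℝ F] [IsManifold 𝓘(ℝ, VB) ∞ B]
  [ContMDiffVectorBundle ∞ F E 𝓘(ℝ, VB)]

/-- Orientation preserving diffeomorphisms of the set of levels act on the tube by radial
diffeomorphisms. -/
theorem exists_radialHom [CompactSpace B] (hf : ContMDiff (bundleModel VB F) 𝓘(ℝ) ∞ f)
    (hhom : IsFiberwiseHomogeneous 2 f) (hdef : IsFiberwiseDefinite f) :
    ∃ θ : diffPlus →ₜ* foliatedDiffeos (bundleModel VB F) f,
      (∀ φ x, ((θ φ : DiffTube (bundleModel VB F) f) x : TotalSpace F E) =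
        fiberSMul √(intervalQuotient φ (f x)) x) ∧
      ∀ φ x, tubeMap f ((θ φ : DiffTube (bundleModel VB F) f) x) =
        (φ : DiffInterval) (tubeMap f x) := by
  choose g hg using exists_radialDiffeo hf hhom hdef
  have hgf : ∀ φ x, tubeMap f (g φ x) = (φ : DiffInterval) (tubeMap f x) := fun φ x =>
    Subtype.ext (by
      change f (g φ x) = _
      rw [hg, apply_fiberSMul_sqrt_intervalQuotient hf hhom])
  have hmul : ∀ φ ψ, g (φ * ψ) = g φ * g ψ := by
    intro φ ψ
    refine Diffeos.ext fun x => Subtype.ext ?_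
    have h1 : ((g φ * g ψ) x : TotalSpace F E) = fiberSMul (√(intervalQuotient φ (f (g ψ x))) *
        √(intervalQuotient ψ (f x))) x := by
      rw [Diffeos.mul_apply, hg φ, hg ψ, fiberSMul_fiberSMul]
    rw [hg, h1]
    refine fiberSMul_eq_of_apply_eq hf hhom hdef (by positivity) (by positivity) ?_
    rw [← hg, ← h1]
    refine congrArg Subtype.val (?_ : tubeMap f _ = tubeMap f _)
    rw [hgf, Diffeos.mul_apply, hgf, hgf]
    rfl
  have hcont : Continuous g := by
    refine continuous_of_eq_fiberSMul hf hhom hdef (h := fun _ => 1) continuous_const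
      (c := fun φ t => √(intervalQuotient φ t)) (fun φ t ht => ?_) fun φ x => hg φ x
    exact ((smoothFamilyAt_intervalQuotient φ ht).reparam
      continuous_subtype_val.continuousAt).comp_left uniqueDiffOn_Icc_zero_one ht
        (Real.contDiffAt_sqrt (intervalQuotient_pos φ ht).ne')
  have hone : g 1 = 1 := by
    have := hmul 1 1
    rw [one_mul] at this
    exact (mul_eq_left.1 this.symm)
  exact ⟨⟨⟨⟨fun φ => ⟨g φ, mem_foliatedDiffeos_of_semiconj fun x => (hgf φ x).symm⟩,
    Subtype.ext hone⟩, fun φ ψ => Subtype.ext (hmul φ ψ)⟩, hcont.subtype_mk _⟩, hg, hgf⟩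

/-- The action of foliated diffeomorphisms on the set of levels. -/
theorem exists_levelHom [Nonempty B] [Nontrivial F]
    (hf : ContMDiff (bundleModel VB F) 𝓘(ℝ) ∞ f)
    (hhom : IsFiberwiseHomogeneous 2 f) (hdef : IsFiberwiseDefinite f) :
    ∃ σ : foliatedDiffeos (bundleModel VB F) f →ₜ* diffPlus, ∀ h (x : tube f),
      (σ h : DiffInterval) (tubeMap f x) =
        tubeMap f ((h : DiffTube (bundleModel VB F) f) x) := by
  obtain ⟨σ, hc, hσ⟩ := exists_levelDiffeo hf hhom hdef
  have hs := tubeMap_surjective hf hhom hdef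
  have hmul : ∀ h k, σ (h * k) = σ h * σ k := fun h k => Diffeos.ext fun t => by
    obtain ⟨x, rfl⟩ := hs t
    rw [Diffeos.mul_apply, hσ, hσ, hσ]
    rfl
  have hone : σ 1 = 1 := by
    have := hmul 1 1
    rw [one_mul] at this
    exact mul_eq_left.1 this.symm
  exact ⟨⟨⟨⟨fun h => ⟨σ h, strictMono_levelDiffeo hf hhom hdef (hσ h)⟩, Subtype.ext hone⟩,
    fun h k => Subtype.ext (hmul h k)⟩, hc.subtype_mk _⟩, hσ⟩

/-- Composing a foliated diffeomorphism with radial diffeomorphisms, one deforms its action on the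
set of levels to the identity. -/
theorem exists_levelHomotopy [CompactSpace B] [Nonempty B] [Nontrivial F]
    (hf : ContMDiff (bundleModel VB F) 𝓘(ℝ) ∞ f)
    (hhom : IsFiberwiseHomogeneous 2 f) (hdef : IsFiberwiseDefinite f) :
    ∃ G : C(foliatedDiffeos (bundleModel VB F) f × unitInterval,
        foliatedDiffeos (bundleModel VB F) f),
      (∀ h, G (h, 0) = h) ∧
      (∀ (h : foliatedDiffeos (bundleModel VB F) f) s, (h : DiffTube (bundleModel VB F) f) ∈
        leafPreservingDiffeos (bundleModel VB F) f → G (h, s) = h) ∧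
      (∀ h, (G (h, 1) : DiffTube (bundleModel VB F) f) ∈
        leafPreservingDiffeos (bundleModel VB F) f) ∧
      ∀ (h : foliatedDiffeos (bundleModel VB F) f) s, (h : DiffTube (bundleModel VB F) f) ∈
        fixingDiffeos (bundleModel VB F) f (tubeBoundary f) →
        (G (h, s) : DiffTube (bundleModel VB F) f) ∈
          fixingDiffeos (bundleModel VB F) f (tubeBoundary f) := by
  obtain ⟨θ, hθ, hθf⟩ := exists_radialHom hf hhom hdef
  obtain ⟨σ, hσ⟩ := exists_levelHom hf hhom hdef
  choose ψ hψ using exists_convexCombination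
  -- The radial factor replaces the level map `σ h` of `h` by the convex combination `ψ (σ h) s`.
  let g : foliatedDiffeos (bundleModel VB F) f × unitInterval →
      foliatedDiffeos (bundleModel VB F) f := fun p => θ (ψ (σ p.1) p.2 * (σ p.1)⁻¹) * p.1
  -- With `q` the quotient of `σ h`, the level `t * q` of the image under `h` must become `(1 - s) *
  -- t * q + s * t`; the ratio is the square of the scaling factor. This closed form spares the
  -- continuity of composition and inversion in the diffeomorphism groups.
  let c : foliatedDiffeos (bundleModel VB F) f × unitInterval → ℝ → ℝ := fun p t =>
    √(((1 - (p.2 : ℝ)) * intervalQuotient (σ p.1) t + p.2) / intervalQuotient (σ p.1) t)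
  have hnum : ∀ (p : foliatedDiffeos (bundleModel VB F) f × unitInterval),
      ∀ t ∈ Icc (0 : ℝ) 1, 0 < (1 - (p.2 : ℝ)) * intervalQuotient (σ p.1) t + p.2 := by
    intro p t ht
    have hp := intervalQuotient_pos (σ p.1) ht
    rcases eq_or_lt_of_le p.2.2.1 with h | h
    · rw [← h]; simpa using hp
    · have := mul_nonneg (sub_nonneg.2 p.2.2.2) hp.le
      linarith
  have hgf : ∀ p (x : tube f), (tubeMap f ((g p : DiffTube (bundleModel VB F) f) x) : ℝ) =
      (1 - (p.2 : ℝ)) * (σ p.1 : DiffInterval) (tubeMap f x) + p.2 * f x := by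
    intro p x
    change (tubeMap f ((θ (ψ (σ p.1) p.2 * (σ p.1)⁻¹) : DiffTube (bundleModel VB F) f)
      ((p.1 : DiffTube (bundleModel VB F) f) x)) : ℝ) = _
    rw [hθf, ← hσ, Subgroup.coe_mul, Diffeos.mul_apply, Subgroup.coe_inv,
      Diffeos.inv_apply_self, hψ]
    rfl
  have hgc : ∀ p (x : tube f), ((g p : DiffTube (bundleModel VB F) f) x : TotalSpace F E) =
      fiberSMul (c p (f x)) ((p.1 : DiffTube (bundleModel VB F) f) x : TotalSpace F E) := by
    intro p x
    have e1 : ((g p : DiffTube (bundleModel VB F) f) x : TotalSpace F E) =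
      fiberSMul _ ((p.1 : DiffTube (bundleModel VB F) f) x : TotalSpace F E) := hθ _ _
    have hq := intervalQuotient_pos (σ p.1) x.2
    have hn := hnum p _ x.2
    have e2 : f ((p.1 : DiffTube (bundleModel VB F) f) x) =
        f x * intervalQuotient (σ p.1) (f x) := by
      rw [mul_intervalQuotient (σ p.1) x.2, intervalFun_of_mem _ x.2]
      exact (congrArg Subtype.val (hσ p.1 x)).symm
    rw [e1]
    refine fiberSMul_eq_of_apply_eq hf hhom hdef (Real.sqrt_nonneg _) (Real.sqrt_nonneg _) ?_
    rw [← e1, hhom.apply_fiberSMul hf, Real.sq_sqrt (div_pos hn hq).le, e2]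
    refine (hgf p x).trans ?_
    rw [hσ]
    change _ * f ((p.1 : DiffTube (bundleModel VB F) f) x) + _ = _
    rw [e2]
    field_simp
  have hcont : Continuous fun p => (g p : DiffTube (bundleModel VB F) f) := by
    refine continuous_of_eq_fiberSMul hf hhom hdef
      (h := fun p : foliatedDiffeos (bundleModel VB F) f × unitInterval =>
        (p.1 : DiffTube (bundleModel VB F) f))
      (continuous_subtype_val.comp continuous_fst) (c := c) (fun p t ht => ?_) hgc
    have hq := intervalQuotient_pos (σ p.1) ht
    have hσc : Continuous fun p : foliatedDiffeos (bundleModel VB F) f × unitInterval =>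
        (σ p.1 : DiffInterval) :=
      continuous_subtype_val.comp (σ.continuous_toFun.comp continuous_fst)
    have h1 := (smoothFamilyAt_intervalQuotient (σ p.1) ht).reparam
      (c := fun p : foliatedDiffeos (bundleModel VB F) f × unitInterval =>
        (σ p.1 : DiffInterval)) (η₀ := p) hσc.continuousAt
    have h2 : SmoothFamilyAt (fun (p : foliatedDiffeos (bundleModel VB F) f × unitInterval)
        (_ : ℝ) => (p.2 : ℝ)) (Icc 0 1) p t :=
      SmoothFamilyAt.param (continuous_subtype_val.comp continuous_snd).continuousAt
    refine (h1.prodMk h2 uniqueDiffOn_Icc_zero_one ht).comp_left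
      (G := fun z : ℝ × ℝ => √(((1 - z.2) * z.1 + z.2) / z.1)) uniqueDiffOn_Icc_zero_one ht ?_
    refine ContDiffAt.sqrt (ContDiffAt.div (by fun_prop) contDiffAt_fst hq.ne') ?_
    exact (div_pos (hnum p t ht) hq).ne'
  have hfix : ∀ p x, tubeMap f ((g p : DiffTube (bundleModel VB F) f) x) =
      tubeMap f ((p.1 : DiffTube (bundleModel VB F) f) x) →
      (g p : DiffTube (bundleModel VB F) f) x = (p.1 : DiffTube (bundleModel VB F) f) x := by
    intro p x h
    have h' : f ((g p : DiffTube (bundleModel VB F) f) x) =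
      f ((p.1 : DiffTube (bundleModel VB F) f) x) := congrArg Subtype.val h
    apply Subtype.ext
    rw [hgc] at h' ⊢
    conv_rhs => rw [← fiberSMul_one (((p.1 : DiffTube (bundleModel VB F) f) x : tube f) :
      TotalSpace F E)]
    refine fiberSMul_eq_of_apply_eq hf hhom hdef (Real.sqrt_nonneg _) zero_le_one ?_
    rw [h', fiberSMul_one]
  refine ⟨⟨g, hcont.subtype_mk _⟩, fun h => ?_, fun h s hh => ?_, fun h => ?_,
    fun h s hh x hx => ?_⟩
  · refine Subtype.ext (Diffeos.ext fun x => hfix (h, 0) x (Subtype.ext ?_))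
    rw [hgf, hσ]
    simp
  · refine Subtype.ext (Diffeos.ext fun x => hfix (h, s) x (Subtype.ext ?_))
    rw [hgf, hσ, mem_leafPreservingDiffeos_iff.1 hh]
    change (1 - (s : ℝ)) * f x + s * f x = f x
    ring
  · refine mem_leafPreservingDiffeos_iff.2 fun x => Subtype.ext ?_
    refine (hgf (h, 1) x).trans ?_
    simp [tubeMap]
  -- On the boundary the level 1 is fixed by `σ h` and by the identity, hence by their convex
  -- combinations, so the radial factor does not move `h x = x`.
  · refine (hfix (h, s) x (Subtype.ext ?_)).trans (hh x hx)
    have hx1 : tubeMap f x = 1 := hx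
    have hx2 : f x = 1 := congrArg Subtype.val hx1
    rw [hgf, hh x hx, hx1, diffPlus_apply_one, hx2]
    simp

end Radial

end

/-! ### Assembly of the split sequences and the retraction -/

theorem mainTheorem5
    {VB : Type*} [NormedAddCommGroup VB] [NormedSpace ℝ VB] [FiniteDimensional ℝ VB]
    {B : Type*} [TopologicalSpace B] [ChartedSpace VB B] [IsManifold 𝓘(ℝ, VB) ∞ B]
    [T2Space B] [CompactSpace B] [Nonempty B]
    {F : Type*} [NormedAddCommGroup F] [NormedSpace ℝ F] [FiniteDimensional ℝ F] [Nontrivial F]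
    {E : B → Type*} [TopologicalSpace (TotalSpace F E)] [∀ b, AddCommGroup (E b)]
    [∀ b, Module ℝ (E b)] [∀ b, TopologicalSpace (E b)] [FiberBundle F E] [VectorBundle ℝ F E]
    [ContMDiffVectorBundle ∞ F E 𝓘(ℝ, VB)]
    (f : TotalSpace F E → ℝ)
    (hf : ContMDiff (bundleModel VB F) 𝓘(ℝ) ∞ f)
    (hhom : IsFiberwiseHomogeneous 2 f) (hdef : IsFiberwiseDefinite f) :
    stabR (bundleModel VB F) f = leafPreservingDiffeos (bundleModel VB F) f ∧
    (∃ (prA : stabLR (bundleModel VB F) f →ₜ* diffPlus) (prM : stabLR (bundleModel VB F) f ≃ₜ* foliatedDiffeos (bundleModel VB F) f)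
        (σ : foliatedDiffeos (bundleModel VB F) f →ₜ* diffPlus) (θ : diffPlus →ₜ* foliatedDiffeos (bundleModel VB F) f)
        (θhat : diffPlus →ₜ* stabLR (bundleModel VB F) f),
      -- `prA` and `prM` are the two projections
      (∀ p, (prA p : DiffInterval) = p.1.1) ∧
      (∀ p, (prM p : DiffTube (bundleModel VB F) f) = p.1.2) ∧
      -- `σ(h) ∘ f = f ∘ h`, and `h ↦ (σ(h), h)` is the inverse of `prM`
      (∀ (h : foliatedDiffeos (bundleModel VB F) f) (x : tube f),
        (σ h : DiffInterval) (tubeMap f x) = tubeMap f ((h : DiffTube (bundleModel VB F) f) x)) ∧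
      (∀ h, (prM.symm h : DiffInterval × DiffTube (bundleModel VB F) f) = (↑(σ h), ↑h)) ∧
      -- `θ(φ)` multiplies a vector `v ∈ T` by the square root of `φ(f(v)) / f(v)`
      -- (if `f(v) = 0`, then `v = 0` and the factor does not matter) and is fixed on `∂T`
      (∀ (φ : diffPlus) (x : tube f),
        ((θ φ : DiffTube (bundleModel VB F) f) x : TotalSpace F E) =
          ⟨x.1.1, √(((φ : DiffInterval) (tubeMap f x) : ℝ) / f x) • x.1.2⟩) ∧
      (∀ φ, (θ φ : DiffTube (bundleModel VB F) f) ∈ fixingDiffeos (bundleModel VB F) f (tubeBoundary f)) ∧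
      (∀ φ, (θhat φ : DiffInterval × DiffTube (bundleModel VB F) f) = (↑φ, ↑(θ φ))) ∧
      -- the two rows are split short exact sequences
      IsSplitShortExact (stabIncl (bundleModel VB F) f) prA θhat ∧
      IsSplitShortExact (lpIncl (bundleModel VB F) f) σ θ ∧
      -- `prM`, with identities at both ends, is a morphism of split short exact sequences
      (∀ h : stabR (bundleModel VB F) f, (prM (stabIncl (bundleModel VB F) f h) : DiffTube (bundleModel VB F) f) = h) ∧
      (∀ p, σ (prM p) = prA p) ∧
      (∀ φ, prM (θhat φ) = θ φ)) ∧
    IsStrongDeformationRetractPair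
      (leafPreservingDiffeos (bundleModel VB F) f : Set (DiffTube (bundleModel VB F) f))
      (↑(leafPreservingDiffeos (bundleModel VB F) f ⊓ fixingDiffeos (bundleModel VB F) f (tubeBoundary f)))
      (foliatedDiffeos (bundleModel VB F) f : Set (DiffTube (bundleModel VB F) f))
      (↑(foliatedDiffeos (bundleModel VB F) f ⊓ fixingDiffeos (bundleModel VB F) f (tubeBoundary f))) := by
  obtain ⟨θ, hθ, hθf⟩ := exists_radialHom hf hhom hdef
  obtain ⟨σ, hσ⟩ := exists_levelHom hf hhom hdef
  have hsurj := tubeMap_surjective hf hhom hdef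
  have hR : stabR (bundleModel VB F) f = leafPreservingDiffeos (bundleModel VB F) f :=
    Subgroup.ext fun h => mem_stabR_iff.trans mem_leafPreservingDiffeos_iff.symm
  have hLR : ∀ (p : stabLR (bundleModel VB F) f) (x : tube f),
      p.1.1 (tubeMap f x) = tubeMap f (p.1.2 x) := fun p x => congrFun p.2 x
  have hmem : ∀ h : foliatedDiffeos (bundleModel VB F) f,
      ((↑(σ h), ↑h) : DiffInterval × DiffTube (bundleModel VB F) f) ∈
        stabLR (bundleModel VB F) f := fun h => funext (hσ h)
  -- Since `f` maps `T` onto `[0, 1]`, the level map is determined by `h`. Hence `prM` is injective,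
  -- and all identities involving `σ` follow.
  have huniq : ∀ {φ ψ : DiffInterval} {h : DiffTube (bundleModel VB F) f},
      (∀ x, φ (tubeMap f x) = tubeMap f (h x)) → (∀ x, ψ (tubeMap f x) = tubeMap f (h x)) →
      φ = ψ := fun h1 h2 => Diffeos.ext fun t => by
    obtain ⟨x, rfl⟩ := hsurj t
    rw [h1, h2]
  have hσθ : ∀ φ, σ (θ φ) = φ := fun φ =>
    Subtype.ext (huniq (hσ (θ φ)) fun x => (hθf φ x).symm)
  have hσ1 : ∀ h, σ h = 1 ↔
      (h : DiffTube (bundleModel VB F) f) ∈ leafPreservingDiffeos (bundleModel VB F) f := by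
    intro h
    rw [mem_leafPreservingDiffeos_iff]
    constructor
    · intro h1 x
      rw [← hσ, h1]
      rfl
    · exact fun h1 => Subtype.ext (huniq (hσ h) fun x => (h1 x).symm)
  let prA : stabLR (bundleModel VB F) f →ₜ* diffPlus :=
    ⟨⟨⟨fun p => ⟨p.1.1, strictMono_levelDiffeo hf hhom hdef (hLR p)⟩, rfl⟩, fun _ _ => rfl⟩,
      (continuous_fst.comp continuous_subtype_val).subtype_mk _⟩
  let prM : stabLR (bundleModel VB F) f ≃ₜ* foliatedDiffeos (bundleModel VB F) f :=
    { toFun := fun p => ⟨p.1.2, mem_foliatedDiffeos_of_semiconj (hLR p)⟩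
      invFun := fun h => ⟨(σ h, h), hmem h⟩
      left_inv := fun p => Subtype.ext (Prod.ext (huniq (hσ _) (hLR p)) rfl)
      right_inv := fun _ => rfl
      map_mul' := fun _ _ => rfl
      continuous_toFun := (continuous_snd.comp continuous_subtype_val).subtype_mk _
      continuous_invFun := ((continuous_subtype_val.comp σ.continuous_toFun).prodMk
        continuous_subtype_val).subtype_mk _ }
  let θhat : diffPlus →ₜ* stabLR (bundleModel VB F) f :=
    ⟨⟨⟨fun φ => ⟨(φ, θ φ), funext fun x => (hθf φ x).symm⟩,
        Subtype.ext (Prod.ext rfl (congrArg Subtype.val (map_one θ)))⟩,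
      fun φ ψ => Subtype.ext (Prod.ext rfl (congrArg Subtype.val (map_mul θ φ ψ)))⟩,
      (continuous_subtype_val.prodMk
        (continuous_subtype_val.comp θ.continuous_toFun)).subtype_mk _⟩
  have hσM : ∀ p, σ (prM p) = prA p := fun p => Subtype.ext (huniq (hσ (prM p)) (hLR p))
  refine ⟨hR, ⟨prA, prM, σ, θ, θhat, fun _ => rfl, fun _ => rfl, hσ, fun _ => rfl, fun φ x => ?_,
    fun φ x hx => ?_, fun _ => rfl, ⟨?_, fun p => ⟨fun hp => ?_, ?_⟩,
      fun φ => ⟨θhat φ, rfl⟩, fun _ => rfl⟩, ⟨?_, fun h => ⟨fun hh => ?_, ?_⟩,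
      fun φ => ⟨θ φ, hσθ φ⟩, hσθ⟩, fun _ => rfl, hσM, fun _ => rfl⟩,
    inf_le_left, inf_le_left, leafPreserving_le_foliated _ _,
    inf_le_inf_right _ (leafPreserving_le_foliated _ _), ?_⟩
  · rw [hθ]
    refine fiberSMul_eq_of_apply_eq hf hhom hdef (Real.sqrt_nonneg _) (Real.sqrt_nonneg _) ?_
    have h0 : 0 ≤ f x := x.2.1
    rw [apply_fiberSMul_sqrt_intervalQuotient hf hhom, hhom.apply_fiberSMul hf,
      Real.sq_sqrt (div_nonneg ((φ : DiffInterval) (tubeMap f x)).2.1 h0)]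
    -- On the zero section division by zero makes the factor 0, which differs from the positive
    -- factor used for `θ`; both give level 0, and this is all that has to be compared.
    rcases h0.eq_or_lt with h | h
    · rw [show tubeMap f x = 0 from Subtype.ext h.symm, diffPlus_apply_zero]
      simp
    · rw [div_mul_cancel₀ _ h.ne']
  · have hx1 : tubeMap f x = 1 := hx
    apply Subtype.ext
    rw [hθ]
    conv_rhs => rw [← fiberSMul_one (x : TotalSpace F E)]
    refine fiberSMul_eq_of_apply_eq hf hhom hdef (Real.sqrt_nonneg _) zero_le_one ?_
    rw [apply_fiberSMul_sqrt_intervalQuotient hf hhom, fiberSMul_one, hx1, diffPlus_apply_one]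
    exact (congrArg Subtype.val hx1).symm
  -- Followed by the projection to the second factor, the map is the inclusion of a subspace; a
  -- continuous map whose composite with a continuous map is an embedding is itself one.
  · refine Topology.IsEmbedding.of_comp (stabIncl (bundleModel VB F) f).continuous_toFun
      (continuous_snd.comp continuous_subtype_val) ?_
    exact Topology.IsEmbedding.subtypeVal
  · have h1 : p.1.1 = 1 := congrArg Subtype.val hp
    refine ⟨⟨p.1.2, mem_stabR_iff.2 fun x => ?_⟩, Subtype.ext (Prod.ext h1.symm rfl)⟩
    rw [← hLR, h1]
    rfl
  · rintro ⟨h, rfl⟩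
    rfl
  · refine Topology.IsEmbedding.of_comp (lpIncl (bundleModel VB F) f).continuous_toFun
      continuous_subtype_val ?_
    exact Topology.IsEmbedding.subtypeVal
  · exact ⟨⟨h, (hσ1 h).1 hh⟩, rfl⟩
  · rintro ⟨k, rfl⟩
    exact (hσ1 _).2 k.2
  · obtain ⟨G, hG0, hGA, hG1, hGX⟩ := exists_levelHomotopy hf hhom hdef
    exact ⟨G, hG0, hGA, hG1, fun h s hh => ⟨(G (h, s)).2, hGX h s hh.2⟩,
      fun h hh => ⟨hG1 h, hGX h 1 hh.2⟩⟩
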